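/- **Setting.** Let $\epsilon>0$ and $\psi\in C^2(\mathbb R^2)$, $\psi=\psi(x,\theta)$, with $\psi_{x\theta}\ge 0$, $\psi(-x,-\theta)=\psi(x,\theta)$ for all $(x,\theta)$, and $\psi_x(x,\theta)=0$ whenever $|x|\ge\epsilon$. Put $\varphi(\theta)=\int_{\mathbb R}\psi_{x\theta}(x,\theta)\,dx$ (the integrand is integrable). For every number $N$ of particles let $\mathbb R^{2N}$ carry the canonical Poisson bracket $\{x_i,p_j\}=\delta_{ij}$, $\{x_i,x_j\}=\{p_i,p_j\}=0$, let $\mathbb R^{2N}_{\ne}=\{(y,\theta):\theta_i\ne\theta_j\ \forall i\ne j\}$, and let $\omega:(y,\theta)\mapsto(x,p)$ be defined by $$y_i=x_i+\sum_{j\ne i}\psi_\theta(x_i-x_j,\theta_i-\theta_j)\quad(1),\qquad p_i=\theta_i+\sum_{j\ne i}\psi_x(x_i-x_j,\theta_i-\theta_j)\quad(2)$$ (solve (1) for $x$; then (2) gives $p$). Let $\theta(x,p)$ be the second component of $\omega^{-1}(x,p)$. The trajectories are $t\mapsto(x(t),p(t))=\omega(y+\theta t,\theta)$. **Theorem.**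 **(a)** For all $(y,\theta)$ the system (1), (2) has exactly one solution $(x,p)$; for fixed $\theta$, $y\mapsto x$ is a $C^1$ diffeomorphism of $\mathbb R^N$ and $x\mapsto p$, given by (2), is $C^1$; for fixed $x$ and all $p$, (2) has the unique solution $\theta=\theta(x,p)$, and $p\mapsto\theta$ is a $C^1$ diffeomorphism of $\mathbb R^N$; $\omega$ is a $C^1$ diffeomorphism of $\mathbb R^{2N}$. The trajectories exist, are unique and are $C^1$ in $t$. For every $(y,\theta)\in\mathbb R^{2N}_{\ne}$ there is $T>0$ such that for all $|t|\ge T$ one has $\dot x(t)=p(t)=\theta$, and $x(t)-\theta t$ is constant on $[T,\infty)$ and on $(-\infty,-T]$. **(b)** The Hamiltonian $H_\psi(x,p)=\sum_i\theta_i(x,p)^2/2=\sum_i p_i^2/2+V_\psi(x,p)$ is $C^1$ and invariant under re-labelling of the particles, and the solutions of Hamilton's equations $\dot x_i=\{x_i,H_\psi\}$, $\dot p_i=\{p_i,H_\psi\}$ are exactly the trajectories above. The system is *Liouville integrable with finite-range interaction* of range $\epsilon$, meaning the following. For $x\in\mathbb R^N$ let $P_\epsilon(x)$ be the partition of $\{1,\dots,N\}$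 into clusters: $i,j$ lie in the same cluster iff they are joined by a chain of particles with successive distances $\le\epsilon$. A family $V$ of functions on $\mathbb R^{2N}$, $N=0,1,2,\dots$, has finite range $\epsilon$ if there are $V^{(n)}\in C^1(\mathbb R^{2n})$, independent of $N$, with $V^{(1)}=0$ and $V(x,p)=\sum_{I\in P_\epsilon(x)}V^{(|I|)}(x_I,p_I)$ for all $N$ and $(x,p)$. The property is that there are functions $E_a\in C^1(\mathbb R)$ and $Q_a\in C^1(\mathbb R^{2N})$ ($a=1,2,\dots$) with $\{Q_a,Q_b\}=0$ for all $a,b$, with $Q_a=\sum_iE_a(p_i)+V_a$ for $C^1$ functions $V_a$ of finite range $\epsilon$, and such that for every $N\ge1$: $Q_1,\dots,Q_N$ are non-constant and functionally independent (differentials linearly independent on a dense set), so are $\sum_iE_1(p_i),\dots,\sum_iE_N(p_i)$ functionally independent, and $H_\psi=\sum_{a=1}^Nc_aQ_a$ with constants $c_a$, not all zero. Explicitly: the functions $Q_a=\sum_i\theta_i(x,p)^a$ are $C^1$ and in involution, $Q_1,\dots,Q_N$ are functionally independent for each $N$, $Q_a-\sum_ip_i^a$ is $C^1$ and has finite range $\epsilon$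 for each $a$, and $H_\psi=\frac12Q_2$; also $V_\psi$ has finite range $\epsilon$. In particular, if $J\subset\{1,\dots,N\}$ and $|x_i-x_j|>\epsilon$ for all $i\notin J$, $j\in J$, then $\theta_j(x,p)=\theta_j(x_J,p_J)$ for all $j\in J$, the right-hand side being computed for the $|J|$-particle system; and if the particles in $J$ evolve alone under the $|J|$-particle $H_\psi$ from $(x_J,p_J)$, then $x_j(t)/t\to\theta_j(x,p)$ as $t\to\infty$. **(c)** $H_\psi$ has *elastic, factorised scattering* and is a *finite-range tracer dynamics* with range $\epsilon$ and two-body shift $\varphi(\theta-\theta')$, which is $C^1$ in $(\theta,\theta')$. The first means that for every $N$ there is a dense set $S'\subset\mathbb R^{2N}$, invariant under the globally defined, unique time evolution, such that for all $(x(0),p(0))\in S'$ there are pairwise distinct $\theta_i$, reals $x_i^\pm$ and a permutation $\sigma$ with $$p_i(t)\to\theta_i,\quad x_i(t)-\theta_it\to x_i^-\quad(t\to-\infty),\qquad p_i(t)\to\theta_{\sigma(i)},\quad x_i(t)-\theta_{\sigma(i)}t\to x_{\sigma(i)}^+\quad(t\to+\infty),$$ $$x_i^+-x_i^-=\sum_{j\ne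 i}\operatorname{sgn}(\theta_j-\theta_i)\,\varphi(\theta_i-\theta_j),$$ and that $(x(0),p(0))\mapsto(x^-,\theta)$ is a bijection $S'\to\mathbb R^{2N}_{\ne}$. The second means that, moreover, $S'$ can be chosen with $\sigma=1$ on all of $S'$, and there are $\theta^{(n,r)}\in C^1(\mathbb R^{2n})$ ($1\le r\le n$), independent of $N$, such that the asymptotic momenta $\theta_i$ extend from $S'$ to $C^1$ functions of $(x,p)\in\mathbb R^{2N}$ with $\theta_{I(r)}(x,p)=\theta^{(|I|,r)}(x_I,p_I)$ for all $(x,p)\in\mathbb R^{2N}$, all clusters $I\in P_\epsilon(x)$ and $1\le r\le|I|$, where $I(r)$ is the $r$-th element of $I$. -/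

import Mathlib

open Filter Topology MeasureTheory

noncomputable section

namespace Bethe

/-! ### Phase space, Poisson bracket, Hamiltonian dynamics -/

/-- The `N`-particle phase space `ℝ^{2N}`; a point is a pair (positions, momenta). -/
abbrev Phase (N : ℕ) : Type := (Fin N → ℝ) × (Fin N → ℝ)

/-- `∂f/∂x_i`. -/
def dPos {N : ℕ} (i : Fin N) (f : Phase N → ℝ) (z : Phase N) : ℝ :=
  fderiv ℝ f z (Pi.single i 1, 0)

/-- `∂f/∂p_i`. -/
def dMom {N : ℕ} (i : Fin N) (f : Phase N → ℝ) (z : Phase N) : ℝ :=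
  fderiv ℝ f z (0, Pi.single i 1)

/-- The canonical Poisson bracket, normalised by `{x_i, p_j} = δ_{ij}`. -/
def poisson {N : ℕ} (f g : Phase N → ℝ) (z : Phase N) : ℝ :=
  ∑ i, (dPos i f z * dMom i g z - dMom i f z * dPos i g z)

/-- A (global) solution of Hamilton's equations `x_i' = {x_i, H}`, `p_i' = {p_i, H}`. -/
def IsTrajectory {N : ℕ} (H : Phase N → ℝ) (γ : ℝ → Phase N) : Prop :=
  ∀ (t : ℝ) (i : Fin N),
    HasDerivAt (fun s => (γ s).1 i) (poisson (fun z => z.1 i) H (γ t)) t ∧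
    HasDerivAt (fun s => (γ s).2 i) (poisson (fun z => z.2 i) H (γ t)) t

/-- `Φ` is the flow generated by `H`: from every initial point there is exactly one global
trajectory, and it is `t ↦ Φ t z`. -/
def IsHamiltonianFlow {N : ℕ} (H : Phase N → ℝ) (Φ : ℝ → Phase N → Phase N) : Prop :=
  ∀ (z : Phase N) (γ : ℝ → Phase N), (IsTrajectory H γ ∧ γ 0 = z) ↔ γ = fun t => Φ t z

/-- A bijection that is `C¹` together with its inverse. -/
def IsC1Diffeo {E F : Type*} [NormedAddCommGroup E] [NormedSpace ℝ E]
    [NormedAddCommGroup F] [NormedSpace ℝ F] (f : E → F) : Prop :=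
  ∃ e : E ≃ F, (∀ v, e v = f v) ∧ ContDiff ℝ 1 e ∧ ContDiff ℝ 1 e.symm

/-- Functional independence: the differentials are linearly independent on a dense set
(for `C¹` functions this set is automatically open). -/
def FunctionallyIndependent {ι E : Type*} [NormedAddCommGroup E] [NormedSpace ℝ E]
    (f : ι → E → ℝ) : Prop :=
  Dense {z : E | LinearIndependent ℝ (fun a => fderiv ℝ (f a) z)}

/-- The points `(y, θ)` of `ℝ^{2N}` with `θ_i ≠ θ_j` for all `i ≠ j`. -/
def distinctMomenta (N : ℕ) : Set (Phase N) :=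
  {w | ∀ i j, i ≠ j → w.2 i ≠ w.2 j}

/-! ### Many-particle systems, clusters, finite-range Liouville integrability -/

/-- A many-particle system: a sequence of `C¹` Hamiltonians, one for each particle number,
each invariant under re-labelling of the particles. -/
def IsManyParticleSystem (H : (N : ℕ) → Phase N → ℝ) : Prop :=
  ∀ N, ContDiff ℝ 1 (H N) ∧
    ∀ (σ : Equiv.Perm (Fin N)) (z : Phase N), H N (z.1 ∘ σ, z.2 ∘ σ) = H N z

/-- The coordinates `(x_I, p_I)` of the particles in `I`, in increasing order of the indices. -/
def restrict {N : ℕ} (I : Finset (Fin N)) (z : Phase N) : Phase I.card :=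
  (fun r => z.1 (I.orderEmbOfFin rfl r), fun r => z.2 (I.orderEmbOfFin rfl r))

open Classical in
/-- The partition `P_ε(x)` into clusters: two particles are in the same cluster when a chain of
particles, each within distance `ε` of the next, joins them. It is the finest partition for which
particles of different clusters are more than `ε` apart. -/
def clusters {N : ℕ} (ε : ℝ) (x : Fin N → ℝ) : Finset (Finset (Fin N)) :=
  (Finpartition.ofSetoid (Relation.EqvGen.setoid (fun i j : Fin N => |x i - x j| ≤ ε))).parts

/-- A sequence of quasi-potentials has finite range `ε`, uniformly in the particle number:
it is a sum over clusters of functions that depend only on the number of particles in the cluster,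
and the one-particle function vanishes. -/
def HasFiniteRange (ε : ℝ) (V : (N : ℕ) → Phase N → ℝ) : Prop :=
  ∃ W : (n : ℕ) → Phase n → ℝ,
    (∀ n, ContDiff ℝ 1 (W n)) ∧ (∀ z, W 1 z = 0) ∧
    ∀ (N : ℕ) (z : Phase N), V N z = ∑ I ∈ clusters ε z.1, W I.card (restrict I z)

/-- `Q = ∑ E(p_i) + V`, with `V` a `C¹` quasi-potential of finite range `ε`, uniformly in `N`. -/
def HasFiniteRangeInteraction (ε : ℝ) (E : ℝ → ℝ) (Q : (N : ℕ) → Phase N → ℝ) : Prop :=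
  ∃ V : (N : ℕ) → Phase N → ℝ,
    (∀ N, ContDiff ℝ 1 (V N)) ∧
    (∀ (N : ℕ) (z : Phase N), Q N z = ∑ i, E (z.2 i) + V N z) ∧
    HasFiniteRange ε V

/-- `H` is Liouville integrable with conserved quantities `Q_1, …, Q_N`. -/
def IsLiouvilleIntegrable {N : ℕ} (H : Phase N → ℝ) (Q : Fin N → Phase N → ℝ) : Prop :=
  (∀ a, ContDiff ℝ 1 (Q a)) ∧
  (∀ a, ¬ ∃ k : ℝ, ∀ z, Q a z = k) ∧
  FunctionallyIndependent Q ∧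
  (∀ a b z, poisson (Q a) (Q b) z = 0) ∧
  ∃ c : Fin N → ℝ, (∃ a, c a ≠ 0) ∧ ∀ z, H z = ∑ a, c a * Q a z

/-- Liouville integrability with finite-range interaction of range `ε`: there are dispersion
relations `E_0, E_1, …` and conserved quantities `Q_0, Q_1, …` (given for all particle numbers) such
that the first `N` of them make the `N`-particle system Liouville integrable, and all of them have
interactions of finite range `ε`, uniformly in `N`. -/
def IsFiniteRangeLiouvilleIntegrable (ε : ℝ) (H : (N : ℕ) → Phase N → ℝ) : Prop :=
  IsManyParticleSystem H ∧
  ∃ (E : ℕ → ℝ → ℝ) (Q : ℕ → (N : ℕ) → Phase N → ℝ),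
    (∀ a, ContDiff ℝ 1 (E a)) ∧
    (∀ N, 1 ≤ N →
      FunctionallyIndependent (fun (a : Fin N) (p : Fin N → ℝ) => ∑ i, E a (p i))) ∧
    (∀ N, 1 ≤ N → IsLiouvilleIntegrable (H N) (fun a : Fin N => Q a N)) ∧
    (∀ (N a b : ℕ) (z : Phase N), poisson (Q a N) (Q b N) z = 0) ∧
    ∀ a, HasFiniteRangeInteraction ε (E a) (Q a)

/-! ### Scattering -/

/-- The `N`-particle Hamiltonian `H` scatters elastically with two-body shift `φ(θ, θ')`, where
`S` is the dense invariant set of initial conditions and, as functions of the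
initial condition in `S`, `θ` are the asymptotic momenta, `xm` and `xp` the impact parameters
`x^-` and `x^+`, and `σ` the permutation of the outgoing particles. -/
structure IsFactorisedScattering {N : ℕ} (H : Phase N → ℝ) (φ : ℝ → ℝ → ℝ)
    (S : Set (Phase N)) (θ xm xp : Phase N → Fin N → ℝ)
    (σ : Phase N → Equiv.Perm (Fin N)) : Prop where
  flow : ∃ Φ : ℝ → Phase N → Phase N, IsHamiltonianFlow H Φ ∧ ∀ t, ∀ z ∈ S, Φ t z ∈ S
  dense : Dense S
  distinct : ∀ z ∈ S, ∀ i j, i ≠ j → θ z i ≠ θ z j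
  incoming : ∀ z ∈ S, ∀ γ, IsTrajectory H γ → γ 0 = z → ∀ i,
    Tendsto (fun t => (γ t).2 i) atBot (𝓝 (θ z i)) ∧
    Tendsto (fun t => (γ t).1 i - θ z i * t) atBot (𝓝 (xm z i))
  outgoing : ∀ z ∈ S, ∀ γ, IsTrajectory H γ → γ 0 = z → ∀ i,
    Tendsto (fun t => (γ t).2 i) atTop (𝓝 (θ z (σ z i))) ∧
    Tendsto (fun t => (γ t).1 i - θ z (σ z i) * t) atTop (𝓝 (xp z (σ z i)))
  shift : ∀ z ∈ S, ∀ i, xp z i - xm z i =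
    ∑ j ∈ Finset.univ.erase i, Real.sign (θ z j - θ z i) * φ (θ z i) (θ z j)
  bijective : Set.BijOn (fun z => ((xm z, θ z) : Phase N)) S (distinctMomenta N)

/-- The elastic, factorised scattering condition with two-body shift `φ(θ, θ')`. -/
def HasElasticFactorisedScattering (H : (N : ℕ) → Phase N → ℝ) (φ : ℝ → ℝ → ℝ) : Prop :=
  IsManyParticleSystem H ∧ ContDiff ℝ 1 (fun q : ℝ × ℝ => φ q.1 q.2) ∧
  ∀ N, ∃ S θ xm xp σ, IsFactorisedScattering (H N) φ S θ xm xp σ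

/-- Finite-range tracer dynamics with interaction range `ε` and two-body shift `φ(θ, θ')`: the
system scatters elastically and factorises, with `σ = 1` for all initial conditions in `S`; and the
asymptotic momenta, extended (necessarily uniquely) from the dense set `S` to `C¹` functions on the
whole phase space, are given in each cluster `I` by functions
`Θ^{(|I|, r)}(x_I, p_I)` that depend on nothing but the number of particles in the cluster. -/
def IsFiniteRangeTracerDynamics (ε : ℝ) (H : (N : ℕ) → Phase N → ℝ) (φ : ℝ → ℝ → ℝ) : Prop :=
  IsManyParticleSystem H ∧ ContDiff ℝ 1 (fun q : ℝ × ℝ => φ q.1 q.2) ∧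
  ∃ Θ : (n : ℕ) → Fin n → Phase n → ℝ,
    (∀ n r, ContDiff ℝ 1 (Θ n r)) ∧
    ∀ N, ∃ S θ xm xp σ,
      IsFactorisedScattering (H N) φ S θ xm xp σ ∧
      (∀ z ∈ S, σ z = 1) ∧
      ContDiff ℝ 1 θ ∧
      ∀ (z : Phase N), ∀ I ∈ clusters ε z.1, ∀ r : Fin I.card,
        θ z (I.orderEmbOfFin rfl r) = Θ I.card r (restrict I z)

/-! ### The semiclassical Bethe systems -/

/-- `ψ_x`. -/
def psiX (ψ : ℝ → ℝ → ℝ) (x θ : ℝ) : ℝ := deriv (fun s => ψ s θ) x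

/-- `ψ_θ`. -/
def psiTheta (ψ : ℝ → ℝ → ℝ) (x θ : ℝ) : ℝ := deriv (fun s => ψ x s) θ

/-- `ψ_{xθ}`. -/
def psiXTheta (ψ : ℝ → ℝ → ℝ) (x θ : ℝ) : ℝ := deriv (fun s => psiX ψ x s) θ

/-- `φ(θ) = ∫ ψ_{xθ}(x, θ) dx`. -/
def phi (ψ : ℝ → ℝ → ℝ) (θ : ℝ) : ℝ := ∫ x, psiXTheta ψ x θ

/-- `y_i = x_i + ∑_{j ≠ i} ψ_θ(x_i - x_j, θ_i - θ_j)`. -/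
def betheY {N : ℕ} (ψ : ℝ → ℝ → ℝ) (x θ : Fin N → ℝ) (i : Fin N) : ℝ :=
  x i + ∑ j ∈ Finset.univ.erase i, psiTheta ψ (x i - x j) (θ i - θ j)

/-- `p_i = θ_i + ∑_{j ≠ i} ψ_x(x_i - x_j, θ_i - θ_j)`. -/
def betheP {N : ℕ} (ψ : ℝ → ℝ → ℝ) (x θ : Fin N → ℝ) (i : Fin N) : ℝ :=
  θ i + ∑ j ∈ Finset.univ.erase i, psiX ψ (x i - x j) (θ i - θ j)

/-- The system of equations that relates `w = (y, θ)` and `z = (x, p)`. -/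
def BetheEquations {N : ℕ} (ψ : ℝ → ℝ → ℝ) (w z : Phase N) : Prop :=
  w.1 = betheY ψ z.1 w.2 ∧ z.2 = betheP ψ z.1 w.2

/-- The position component `x` of `ω(y, θ)`: the solution of `y = betheY ψ x θ`. -/
def solveX {N : ℕ} (ψ : ℝ → ℝ → ℝ) (θ y : Fin N → ℝ) : Fin N → ℝ :=
  Function.invFun (fun x => betheY ψ x θ) y

/-- The map `ω : (y, θ) ↦ (x, p)`: solve the first equation for `x`, then the second one
gives `p`. -/
def omega {N : ℕ} (ψ : ℝ → ℝ → ℝ) (w : Phase N) : Phase N :=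
  (solveX ψ w.2 w.1, betheP ψ (solveX ψ w.2 w.1) w.2)

/-- The momenta `θ(x, p)`: the second component of `ω⁻¹(x, p)`. -/
def theta {N : ℕ} (ψ : ℝ → ℝ → ℝ) (z : Phase N) : Fin N → ℝ :=
  (Function.invFun (omega ψ) z).2

/-- The free evolution `τ_t (y, θ) = (y + θ t, θ)`. -/
def tau {N : ℕ} (t : ℝ) (w : Phase N) : Phase N := (fun i => w.1 i + w.2 i * t, w.2)

/-- The charges `Q_a = ∑ θ_i(x, p)^a`. -/
def charge (ψ : ℝ → ℝ → ℝ) (a : ℕ) (N : ℕ) (z : Phase N) : ℝ := ∑ i, theta ψ z i ^ a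

/-- The Hamiltonian `H_ψ = ∑ θ_i(x, p)² / 2`. -/
def Hpsi (ψ : ℝ → ℝ → ℝ) (N : ℕ) (z : Phase N) : ℝ := ∑ i, theta ψ z i ^ 2 / 2

/-- The quasi-potential `V_ψ = ∑ (θ_i(x, p)² - p_i²) / 2`. -/
def Vpsi (ψ : ℝ → ℝ → ℝ) (N : ℕ) (z : Phase N) : ℝ := ∑ i, (theta ψ z i ^ 2 - z.2 i ^ 2) / 2

end Bethe

end

/-! Everything is done in the mixed coordinates `(x, θ)`. Put `Φ(x, θ) = ∑ x_i θ_i + ½ ∑_{i,j} ψ(x_i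
- x_j, θ_i - θ_j)` (`generating`). Because `ψ` is even, the defining equations say `y = ∂Φ/∂θ` and
`p = ∂Φ/∂x`, so `Φ` generates `ω`.

Solvability: `ψ_{xθ} ≥ 0` makes `ψ_θ` monotone in `x` and `ψ_x` monotone in `θ`, and both are odd.
Hence `x ↦ y` at fixed `θ` and `θ ↦ p` at fixed `x` are the identity plus a monotone map, and such
`C¹` maps are global diffeomorphisms (`StronglyMonotone.isC1Diffeo`). Composing, `ω` is one too.

Dynamics: symmetry of the second derivative of `Φ` makes `ω` symplectic (`sform_fderiv_omega`).
Pulled back by `ω`, `H_ψ` is the free Hamiltonian and the charges depend on `θ` only. So the charges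
commute, and the trajectories are the images of free motion (`isTrajectory_Hpsi_iff`). Independence
of the charges is a Vandermonde argument.

Locality: the equation for `θ` at given `(x, p)` couples only particles at distance less than `ε`,
since `ψ_x` vanishes beyond. By uniqueness of its solution, `θ` is computed cluster by cluster
(`theta_restrict`).

Scattering: for fixed `θ`, `ψ_θ` is bounded in `x` and constant on each side of the range. Thus `x_i
- θ_i t` stays bounded, and distinct momenta eventually order the particles with gaps at least `ε`.
From then on `p = θ`, and each `ψ_θ` equals its value at `±ε` (`exists_omega_tau_eq`). The jump of
`ψ_θ` from `-ε` to `ε` is `φ`, which gives the shift. -/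

namespace Bethe

/-! ### Global `C¹` diffeomorphisms -/

section Diffeo

variable {E F : Type*} [NormedAddCommGroup E] [NormedSpace ℝ E]
  [NormedAddCommGroup F] [NormedSpace ℝ F]

theorem IsC1Diffeo.bijective {f : E → F} (hf : IsC1Diffeo f) : Function.Bijective f := by
  obtain ⟨e, he, -, -⟩ := hf
  rw [show f = e from funext fun v => (he v).symm]
  exact e.bijective

theorem IsC1Diffeo.contDiff {f : E → F} (hf : IsC1Diffeo f) : ContDiff ℝ 1 f := by
  obtain ⟨e, he, h, -⟩ := hf
  rwa [show f = e from funext fun v => (he v).symm]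

theorem IsC1Diffeo.contDiff_of_rightInverse {f : E → F} (hf : IsC1Diffeo f) {g : F → E}
    (hg : ∀ y, f (g y) = y) : ContDiff ℝ 1 g := by
  obtain ⟨e, he, -, h⟩ := hf
  rwa [show g = e.symm from funext fun y => by rw [Equiv.eq_symm_apply, he, hg]]

theorem IsC1Diffeo.of_rightInverse {f : E → F} (hf : IsC1Diffeo f) {g : F → E}
    (hg : ∀ y, f (g y) = y) : IsC1Diffeo g := by
  obtain ⟨e, he, h, h'⟩ := hf
  refine ⟨e.symm, fun y => ?_, h', by simpa using h⟩
  rw [Equiv.symm_apply_eq, he, hg]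

theorem IsC1Diffeo.comp {G : Type*} [NormedAddCommGroup G] [NormedSpace ℝ G] {g : F → G}
    {f : E → F} (hg : IsC1Diffeo g) (hf : IsC1Diffeo f) : IsC1Diffeo (g ∘ f) := by
  obtain ⟨e, he, h, h'⟩ := hf
  obtain ⟨d, hd, k, k'⟩ := hg
  exact ⟨e.trans d, fun v => by simp [he, hd], k.comp h, h'.comp k'⟩

/-- An injective derivative of an endomap of a finite-dimensional space is invertible. -/
theorem exists_fderiv_equiv [FiniteDimensional ℝ E] {f : E → E} (hf : ContDiff ℝ 1 f)
    (hinj : ∀ x v, fderiv ℝ f x v = 0 → v = 0) :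
    ∃ f' : E → E ≃L[ℝ] E, ∀ x, HasStrictFDerivAt f (f' x : E →L[ℝ] E) x := by
  have hi : ∀ x, Function.Injective (fderiv ℝ f x).toLinearMap := fun x =>
    (injective_iff_map_eq_zero _).2 (hinj x)
  refine ⟨fun x => (LinearEquiv.ofInjectiveEndo _ (hi x)).toContinuousLinearEquiv, fun x => ?_⟩
  convert (hf.contDiffAt (x := x)).hasStrictFDerivAt one_ne_zero using 1
  ext v
  simp

/-- The inverse function theorem makes `f` open, hence a homeomorphism, and invertibility of the
derivative then gives smoothness of the inverse. -/
theorem isC1Diffeo_of_bijective [FiniteDimensional ℝ E] {f : E → E} (hf : ContDiff ℝ 1 f)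
    (hbij : Function.Bijective f) (hinj : ∀ x v, fderiv ℝ f x v = 0 → v = 0) :
    IsC1Diffeo f := by
  have : CompleteSpace E := FiniteDimensional.complete ℝ E
  obtain ⟨f', hf'⟩ := exists_fderiv_equiv hf hinj
  let h : E ≃ₜ E := (Equiv.ofBijective f hbij).toHomeomorphOfContinuousOpen hf.continuous
    (isOpenMap_of_hasStrictFDerivAt_equiv hf')
  exact ⟨h.toEquiv, fun _ => rfl, hf,
    h.contDiff_symm (f₀' := f') (fun a => (hf' a).hasFDerivAt) hf⟩

end Diffeo

/-- Strong monotonicity with respect to the standard inner product. -/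
def StronglyMonotone {N : ℕ} (f : (Fin N → ℝ) → Fin N → ℝ) : Prop :=
  ∀ x x', ∑ i, (x i - x' i) ^ 2 ≤ ∑ i, (x i - x' i) * (f x i - f x' i)

/-! ### Strongly monotone `C¹` maps are global diffeomorphisms -/

namespace StronglyMonotone

variable {N : ℕ} {f : (Fin N → ℝ) → Fin N → ℝ}

theorem sum_sq_le (hm : StronglyMonotone f) (x x' : Fin N → ℝ) :
    ∑ i, (x i - x' i) ^ 2 ≤ ∑ i, (f x i - f x' i) ^ 2 := by
  have h := hm x x'
  have h2 : ∑ i, (x i - x' i) * (f x i - f x' i) ≤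
      ∑ i, ((x i - x' i) ^ 2 / 2 + (f x i - f x' i) ^ 2 / 2) :=
    Finset.sum_le_sum fun i _ => by nlinarith [sq_nonneg ((x i - x' i) - (f x i - f x' i))]
  rw [Finset.sum_add_distrib, ← Finset.sum_div, ← Finset.sum_div] at h2
  linarith

/-- The norm here is the sup norm, so comparison with sums of squares costs a factor `√N`; `N + 1`
is a crude substitute that stays positive for `N = 0`. -/
theorem norm_sub_le_mul (hm : StronglyMonotone f) (x x' : Fin N → ℝ) :
    ‖x - x'‖ ≤ (N + 1) * ‖f x - f x'‖ := by
  refine (pi_norm_le_iff_of_nonneg (by positivity)).2 fun k => ?_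
  refine abs_le_of_sq_le_sq ?_ (by positivity)
  have h1 : (x k - x' k) ^ 2 ≤ ∑ i, (x i - x' i) ^ 2 :=
    Finset.single_le_sum (f := fun i => (x i - x' i) ^ 2) (fun i _ => sq_nonneg _)
      (Finset.mem_univ k)
  have h2 : ∑ i, (f x i - f x' i) ^ 2 ≤ ∑ _i : Fin N, ‖f x - f x'‖ ^ 2 :=
    Finset.sum_le_sum fun i _ => sq_le_sq' (neg_le_of_abs_le (norm_le_pi_norm (f x - f x') i))
      (le_of_abs_le (norm_le_pi_norm (f x - f x') i))
  simp only [Finset.sum_const, Finset.card_univ, Fintype.card_fin, nsmul_eq_mul] at h2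
  have h3 := hm.sum_sq_le x x'
  have h4 : (N : ℝ) * ‖f x - f x'‖ ^ 2 ≤ ((N + 1) * ‖f x - f x'‖) ^ 2 := by
    rw [mul_pow]
    have : (0 : ℝ) ≤ N := N.cast_nonneg
    gcongr
    nlinarith
  simp only [Pi.sub_apply]
  linarith

theorem injective (hm : StronglyMonotone f) : Function.Injective f := fun x x' h => by
  have := hm.norm_sub_le_mul x x'
  rw [h, sub_self, norm_zero, mul_zero] at this
  exact sub_eq_zero.1 (norm_le_zero_iff.1 this)

/-- The difference quotients of `f` along `v` have norm at least `‖v‖ / (N + 1)`, and this bound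
survives in the limit. -/
theorem fderiv_injective (hm : StronglyMonotone f) (hf : ContDiff ℝ 1 f) (x v : Fin N → ℝ)
    (hv : fderiv ℝ f x v = 0) : v = 0 := by
  have hd : HasDerivAt (fun t : ℝ => f (x + t • v)) 0 0 := by
    have h1 : HasDerivAt (fun t : ℝ => x + t • v) v 0 := by
      simpa using ((hasDerivAt_id (0 : ℝ)).smul_const v).const_add x
    have h2 : HasFDerivAt f (fderiv ℝ f x) (x + (0 : ℝ) • v) := by
      simpa using (hf.differentiable one_ne_zero x).hasFDerivAt
    have h3 := h2.comp_hasDerivAt (0 : ℝ) h1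
    rwa [hv] at h3
  have hs := hasDerivAt_iff_tendsto_slope_zero.1 hd
  have hb : ∀ᶠ t : ℝ in 𝓝[≠] 0,
      ‖v‖ ≤ (N + 1) * ‖t⁻¹ • (f (x + (0 + t) • v) - f (x + (0 : ℝ) • v))‖ := by
    filter_upwards [self_mem_nhdsWithin] with t ht
    have h := hm.norm_sub_le_mul (x + (0 + t) • v) (x + (0 : ℝ) • v)
    have ht' : 0 < |t| := abs_pos.2 ht
    rw [show x + (0 + t) • v - (x + (0 : ℝ) • v) = t • v by simp, norm_smul,
      Real.norm_eq_abs] at h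
    rw [norm_smul, norm_inv, Real.norm_eq_abs]
    calc ‖v‖ = |t|⁻¹ * (|t| * ‖v‖) := by field_simp
      _ ≤ |t|⁻¹ * ((N + 1) * ‖f (x + (0 + t) • v) - f (x + (0 : ℝ) • v)‖) := by gcongr
      _ = _ := by ring
  have := ge_of_tendsto (hs.norm.const_mul ((N : ℝ) + 1)) hb
  simpa using this

/-- Surjectivity is by connectedness: the range is open by the inverse function theorem, and closed
because expansion makes `f` proper. -/
theorem isC1Diffeo (hm : StronglyMonotone f) (hf : ContDiff ℝ 1 f) : IsC1Diffeo f := by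
  refine isC1Diffeo_of_bijective hf ⟨hm.injective, ?_⟩ (hm.fderiv_injective hf)
  obtain ⟨f', hf'⟩ := exists_fderiv_equiv hf (hm.fderiv_injective hf)
  have ho : IsOpen (Set.range f) := (isOpenMap_of_hasStrictFDerivAt_equiv hf').isOpen_range
  have hc : IsClosed (Set.range f) := by
    refine (isProperMap_iff_tendsto_cocompact.2 ⟨hf.continuous, ?_⟩).isClosedMap.isClosed_range
    rw [← Metric.cobounded_eq_cocompact, ← comap_norm_atTop, tendsto_comap_iff]
    have h : Tendsto (fun x : Fin N → ℝ => (‖x‖ / (N + 1) - ‖f 0‖))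
        (comap norm atTop) atTop :=
      tendsto_atTop_add_const_right _ _ (tendsto_comap.atTop_div_const (by positivity))
    refine tendsto_atTop_mono (fun x => ?_) h
    have h1 := hm.norm_sub_le_mul x 0
    have h2 := norm_sub_le (f x) (f 0)
    rw [sub_zero] at h1
    have : ‖x‖ / (N + 1) ≤ ‖f x - f 0‖ := by
      rw [div_le_iff₀ (by positivity)]; linarith
    simp only [Function.comp_apply]
    linarith
  exact Set.range_eq_univ.1 (IsClopen.eq_univ ⟨hc, ho⟩ ⟨f 0, 0, rfl⟩)

end StronglyMonotone

/-! ### The two-body function -/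

/-- The hypotheses on the two-body function `ψ`, with range `ε`. -/
structure IsBetheKernel (ψ : ℝ → ℝ → ℝ) (ε : ℝ) : Prop where
  pos : 0 < ε
  smooth : ContDiff ℝ 2 (fun q : ℝ × ℝ => ψ q.1 q.2)
  nonneg : ∀ x θ, 0 ≤ psiXTheta ψ x θ
  symm : ∀ x θ, ψ (-x) (-θ) = ψ x θ
  range : ∀ x θ, ε ≤ |x| → psiX ψ x θ = 0

namespace IsBetheKernel

variable {ψ : ℝ → ℝ → ℝ} {ε : ℝ}

theorem hasFDerivAt (h : IsBetheKernel ψ ε) (q : ℝ × ℝ) :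
    HasFDerivAt (fun q : ℝ × ℝ => ψ q.1 q.2) (fderiv ℝ (fun q : ℝ × ℝ => ψ q.1 q.2) q) q :=
  (h.smooth.differentiable two_ne_zero q).hasFDerivAt

theorem psiX_eq (h : IsBetheKernel ψ ε) (x θ : ℝ) :
    psiX ψ x θ = fderiv ℝ (fun q : ℝ × ℝ => ψ q.1 q.2) (x, θ) (1, 0) :=
  HasDerivAt.deriv (f := fun s => ψ s θ) ((h.hasFDerivAt (x, θ)).comp_hasDerivAt
    (f := fun s => (s, θ)) x
    ((hasDerivAt_id x).prodMk (hasDerivAt_const x θ)))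

theorem psiTheta_eq (h : IsBetheKernel ψ ε) (x θ : ℝ) :
    psiTheta ψ x θ = fderiv ℝ (fun q : ℝ × ℝ => ψ q.1 q.2) (x, θ) (0, 1) :=
  HasDerivAt.deriv (f := fun s => ψ x s) ((h.hasFDerivAt (x, θ)).comp_hasDerivAt
    (f := fun s => (x, s)) θ
    ((hasDerivAt_const θ x).prodMk (hasDerivAt_id θ)))

theorem fderiv_apply (h : IsBetheKernel ψ ε) (q v : ℝ × ℝ) :
    fderiv ℝ (fun q : ℝ × ℝ => ψ q.1 q.2) q v =
      psiX ψ q.1 q.2 * v.1 + psiTheta ψ q.1 q.2 * v.2 := by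
  rw [h.psiX_eq, h.psiTheta_eq]
  conv_lhs => rw [show v = v.1 • ((1, 0) : ℝ × ℝ) + v.2 • ((0, 1) : ℝ × ℝ) by ext <;> simp]
  rw [map_add, map_smul, map_smul, smul_eq_mul, smul_eq_mul, mul_comm, mul_comm v.2]

theorem contDiff_fderiv (h : IsBetheKernel ψ ε) :
    ContDiff ℝ 1 (fderiv ℝ (fun q : ℝ × ℝ => ψ q.1 q.2)) :=
  h.smooth.fderiv_right (by norm_num)

theorem contDiff_psiX (h : IsBetheKernel ψ ε) :
    ContDiff ℝ 1 (fun q : ℝ × ℝ => psiX ψ q.1 q.2) := by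
  simp only [h.psiX_eq]
  exact h.contDiff_fderiv.clm_apply contDiff_const

theorem contDiff_psiTheta (h : IsBetheKernel ψ ε) :
    ContDiff ℝ 1 (fun q : ℝ × ℝ => psiTheta ψ q.1 q.2) := by
  simp only [h.psiTheta_eq]
  exact h.contDiff_fderiv.clm_apply contDiff_const

theorem hasDerivAt_psiX (h : IsBetheKernel ψ ε) (x θ : ℝ) :
    HasDerivAt (fun s => psiX ψ x s)
      (fderiv ℝ (fderiv ℝ (fun q : ℝ × ℝ => ψ q.1 q.2)) (x, θ) (0, 1) (1, 0)) θ := by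
  simp only [h.psiX_eq]
  have h1 := ((h.contDiff_fderiv.differentiable one_ne_zero (x, θ)).hasFDerivAt).comp_hasDerivAt θ
    ((hasDerivAt_const θ x).prodMk (hasDerivAt_id θ))
  simpa using h1.clm_apply (hasDerivAt_const θ ((1, 0) : ℝ × ℝ))

theorem psiXTheta_eq (h : IsBetheKernel ψ ε) (x θ : ℝ) : psiXTheta ψ x θ =
    fderiv ℝ (fderiv ℝ (fun q : ℝ × ℝ => ψ q.1 q.2)) (x, θ) (0, 1) (1, 0) :=
  (h.hasDerivAt_psiX x θ).deriv

/-- `psiXTheta` differentiates in `x` first; the other order is allowed since `ψ` is `C²`. -/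
theorem hasDerivAt_psiTheta (h : IsBetheKernel ψ ε) (x θ : ℝ) :
    HasDerivAt (fun s => psiTheta ψ s θ) (psiXTheta ψ x θ) x := by
  simp only [h.psiTheta_eq]
  have h1 := ((h.contDiff_fderiv.differentiable one_ne_zero (x, θ)).hasFDerivAt).comp_hasDerivAt x
    ((hasDerivAt_id x).prodMk (hasDerivAt_const x θ))
  have h2 := h1.clm_apply (hasDerivAt_const x ((0, 1) : ℝ × ℝ))
  have hs : IsSymmSndFDerivAt ℝ (fun q : ℝ × ℝ => ψ q.1 q.2) (x, θ) :=
    h.smooth.contDiffAt.isSymmSndFDerivAt (by simp)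
  rw [h.psiXTheta_eq, hs.eq]
  simpa using h2

theorem continuous_psiXTheta (h : IsBetheKernel ψ ε) (θ : ℝ) :
    Continuous (fun x => psiXTheta ψ x θ) := by
  simp only [h.psiXTheta_eq]
  have : Continuous (fderiv ℝ (fderiv ℝ (fun q : ℝ × ℝ => ψ q.1 q.2))) :=
    h.contDiff_fderiv.continuous_fderiv one_ne_zero
  fun_prop

theorem psiX_mono (h : IsBetheKernel ψ ε) (x : ℝ) : Monotone (psiX ψ x) :=
  monotone_of_deriv_nonneg (fun θ => (h.hasDerivAt_psiX x θ).differentiableAt) (h.nonneg x)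

theorem psiTheta_mono (h : IsBetheKernel ψ ε) (θ : ℝ) : Monotone (fun x => psiTheta ψ x θ) :=
  monotone_of_deriv_nonneg (fun x => (h.hasDerivAt_psiTheta x θ).differentiableAt)
    fun x => by rw [(h.hasDerivAt_psiTheta x θ).deriv]; exact h.nonneg x θ

theorem psiX_neg (h : IsBetheKernel ψ ε) (x θ : ℝ) : psiX ψ (-x) (-θ) = -psiX ψ x θ := by
  have : (fun s => ψ s θ) = fun s => ψ (-s) (-θ) := funext fun s => (h.symm s θ).symm
  rw [psiX, psiX, this, deriv_comp_neg (fun s => ψ s (-θ)), neg_neg]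

theorem psiTheta_neg (h : IsBetheKernel ψ ε) (x θ : ℝ) :
    psiTheta ψ (-x) (-θ) = -psiTheta ψ x θ := by
  have : (fun s => ψ x s) = fun s => ψ (-x) (-s) := funext fun s => (h.symm x s).symm
  rw [psiTheta, psiTheta, this, deriv_comp_neg (fun s => ψ (-x) s), neg_neg]

theorem psiX_zero (h : IsBetheKernel ψ ε) : psiX ψ 0 0 = 0 := by
  have := h.psiX_neg 0 0
  rw [neg_zero] at this
  linarith

theorem psiTheta_zero (h : IsBetheKernel ψ ε) : psiTheta ψ 0 0 = 0 := by
  have := h.psiTheta_neg 0 0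
  rw [neg_zero] at this
  linarith

theorem psiXTheta_of_le (h : IsBetheKernel ψ ε) {x : ℝ} (hx : ε ≤ |x|) (θ : ℝ) :
    psiXTheta ψ x θ = 0 := by
  simp only [psiXTheta, h.range x _ hx, deriv_const]

theorem integral_psiXTheta (h : IsBetheKernel ψ ε) (θ a b : ℝ) :
    ∫ x in a..b, psiXTheta ψ x θ = psiTheta ψ b θ - psiTheta ψ a θ :=
  intervalIntegral.integral_eq_sub_of_hasDerivAt (fun x _ => h.hasDerivAt_psiTheta x θ)
    ((h.continuous_psiXTheta θ).intervalIntegrable _ _)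

theorem psiTheta_of_le (h : IsBetheKernel ψ ε) {x : ℝ} (hx : ε ≤ x) (θ : ℝ) :
    psiTheta ψ x θ = psiTheta ψ ε θ := by
  have h1 := h.integral_psiXTheta θ ε x
  have h2 : ∫ y in ε..x, psiXTheta ψ y θ = ∫ _y in ε..x, (0 : ℝ) :=
    intervalIntegral.integral_congr fun y hy => by
      rw [Set.uIcc_of_le hx] at hy
      exact h.psiXTheta_of_le (hy.1.trans (le_abs_self y)) θ
  rw [h2, intervalIntegral.integral_zero] at h1
  linarith

theorem psiTheta_of_le_neg (h : IsBetheKernel ψ ε) {x : ℝ} (hx : x ≤ -ε) (θ : ℝ) :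
    psiTheta ψ x θ = psiTheta ψ (-ε) θ := by
  have h1 := h.psiTheta_neg x θ
  have h2 := h.psiTheta_neg (-ε) θ
  rw [neg_neg] at h2
  rw [h.psiTheta_of_le (by linarith : ε ≤ -x)] at h1
  linarith

/-- By monotonicity in `x` and constancy outside the range, the values lie between those at `-ε` and
`ε`. Uniformity in `x` is what controls the trajectories at all times. -/
theorem abs_psiTheta_le (h : IsBetheKernel ψ ε) (x θ : ℝ) :
    |psiTheta ψ x θ| ≤ |psiTheta ψ ε θ| + |psiTheta ψ (-ε) θ| := by
  have h1 : psiTheta ψ x θ ≤ psiTheta ψ ε θ := by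
    rcases le_total ε x with hx | hx
    · exact (h.psiTheta_of_le hx θ).le
    · exact h.psiTheta_mono θ hx
  have h2 : psiTheta ψ (-ε) θ ≤ psiTheta ψ x θ := by
    rcases le_total x (-ε) with hx | hx
    · exact (h.psiTheta_of_le_neg hx θ).ge
    · exact h.psiTheta_mono θ hx
  rw [abs_le]
  constructor
  · linarith [neg_abs_le (psiTheta ψ (-ε) θ), abs_nonneg (psiTheta ψ ε θ)]
  · linarith [le_abs_self (psiTheta ψ ε θ), abs_nonneg (psiTheta ψ (-ε) θ)]

theorem integrable_psiXTheta (h : IsBetheKernel ψ ε) (θ : ℝ) :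
    Integrable (fun x => psiXTheta ψ x θ) := by
  refine (h.continuous_psiXTheta θ).integrable_of_hasCompactSupport
    (HasCompactSupport.intro (isCompact_Icc (a := -ε) (b := ε)) fun x hx => ?_)
  refine h.psiXTheta_of_le (le_of_not_gt fun hlt => hx ?_) θ
  exact ⟨(abs_lt.1 hlt).1.le, (abs_lt.1 hlt).2.le⟩

theorem phi_eq (h : IsBetheKernel ψ ε) (θ : ℝ) :
    phi ψ θ = psiTheta ψ ε θ - psiTheta ψ (-ε) θ := by
  rw [← h.integral_psiXTheta, phi,
    ← intervalIntegral.integral_eq_integral_of_support_subset]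
  intro x hx
  by_contra hx'
  refine hx (h.psiXTheta_of_le (le_of_not_gt fun hlt => hx' ?_) θ)
  exact ⟨(abs_lt.1 hlt).1, (abs_lt.1 hlt).2.le⟩

theorem contDiff_phi (h : IsBetheKernel ψ ε) :
    ContDiff ℝ 1 (fun q : ℝ × ℝ => phi ψ (q.1 - q.2)) := by
  simp only [h.phi_eq]
  exact (h.contDiff_psiTheta.comp (contDiff_const.prodMk (contDiff_fst.sub contDiff_snd))).sub
    (h.contDiff_psiTheta.comp (contDiff_const.prodMk (contDiff_fst.sub contDiff_snd)))

end IsBetheKernel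

/-! ### The change of variables `(y, θ) ↔ (x, θ) ↔ (x, p)` -/

/-- Bijectivity holds fibre by fibre, and the derivative is block triangular with an identity block,
so its kernel reduces to that of the fibre derivative. -/
theorem isC1Diffeo_fiberwise {N : ℕ} {F : Type*} [NormedAddCommGroup F] [NormedSpace ℝ F]
    [FiniteDimensional ℝ F] {g : (Fin N → ℝ) × F → Fin N → ℝ} (hg : ContDiff ℝ 1 g)
    (hm : ∀ θ, StronglyMonotone fun x => g (x, θ)) :
    IsC1Diffeo fun q : (Fin N → ℝ) × F => (g q, q.2) := by
  have hs : ∀ θ, ContDiff ℝ 1 fun x => g (x, θ) := fun θ =>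
    hg.comp (contDiff_id.prodMk contDiff_const)
  refine isC1Diffeo_of_bijective (hg.prodMk contDiff_snd) ⟨?_, ?_⟩ ?_
  · rintro ⟨x, θ⟩ ⟨x', θ'⟩ he
    obtain ⟨h1, rfl⟩ := Prod.mk.inj he
    rw [(hm θ).injective h1]
  · rintro ⟨y, θ⟩
    obtain ⟨x, hx⟩ := ((hm θ).isC1Diffeo (hs θ)).bijective.surjective y
    exact ⟨(x, θ), by simpa using hx⟩
  · rintro ⟨x, θ⟩ ⟨u, v⟩ he
    have hd := hg.differentiable one_ne_zero (x, θ)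
    rw [(hd.hasFDerivAt.prodMk hasFDerivAt_snd).fderiv] at he
    obtain ⟨h1, h2⟩ := Prod.mk.inj he
    have h2 : v = 0 := h2
    subst h2
    have h3 : HasFDerivAt (fun x => g (x, θ)) _ x :=
      hd.hasFDerivAt.comp (f := fun x => (x, θ)) x ((hasFDerivAt_id x).prodMk (hasFDerivAt_const θ x))
    have h4 : u = 0 := (hm θ).fderiv_injective (hs θ) x u (by rw [h3.fderiv]; exact h1)
    rw [h4]; rfl

theorem isC1Diffeo_swap {E F : Type*} [NormedAddCommGroup E] [NormedSpace ℝ E]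
    [NormedAddCommGroup F] [NormedSpace ℝ F] : IsC1Diffeo (Prod.swap : E × F → F × E) :=
  ⟨Equiv.prodComm E F, fun _ => rfl, contDiff_snd.prodMk contDiff_fst,
    contDiff_snd.prodMk contDiff_fst⟩

theorem sum_antisymm_mul_sub {N : ℕ} {c : Fin N → Fin N → ℝ} (hc : ∀ i j, c j i = -c i j)
    (u : Fin N → ℝ) : ∑ i, ∑ j, c i j * (u i - u j) = 2 * ∑ i, u i * ∑ j, c i j := by
  have h1 : ∑ i, ∑ j, c i j * u j = -∑ i, ∑ j, c i j * u i := by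
    rw [Finset.sum_comm, ← Finset.sum_neg_distrib]
    refine Finset.sum_congr rfl fun i _ => ?_
    rw [← Finset.sum_neg_distrib]
    exact Finset.sum_congr rfl fun j _ => by rw [hc]; ring
  have h2 : ∑ i, u i * ∑ j, c i j = ∑ i, ∑ j, c i j * u i :=
    Finset.sum_congr rfl fun i _ => by rw [mul_comm, Finset.sum_mul]
  simp only [mul_sub, Finset.sum_sub_distrib]
  rw [h1, h2]; ring

/-- Symmetrising in `i, j` turns the contribution of the pair terms into half a sum of products of
an increment of `c i j` with the increment of its argument, each non-negative by monotonicity. -/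
theorem stronglyMonotone_add_pair {N : ℕ} {c : Fin N → Fin N → ℝ → ℝ}
    (hm : ∀ i j, Monotone (c i j)) (hc : ∀ i j s, c j i (-s) = -c i j s) :
    StronglyMonotone fun (x : Fin N → ℝ) i => x i + ∑ j, c i j (x i - x j) := by
  intro x x'
  have h := sum_antisymm_mul_sub (c := fun i j => c i j (x i - x j) - c i j (x' i - x' j))
    (fun i j => by
      rw [← neg_sub (x i) (x j), ← neg_sub (x' i) (x' j), hc, hc]; ring) (fun i => x i - x' i)
  have h0 : 0 ≤ ∑ i, ∑ j, (c i j (x i - x j) - c i j (x' i - x' j)) *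
      ((x i - x' i) - (x j - x' j)) := by
    refine Finset.sum_nonneg fun i _ => Finset.sum_nonneg fun j _ => ?_
    rcases le_total (x i - x j) (x' i - x' j) with hle | hle
    · exact mul_nonneg_of_nonpos_of_nonpos (sub_nonpos.2 (hm i j hle)) (by linarith)
    · exact mul_nonneg (sub_nonneg.2 (hm i j hle)) (by linarith)
  rw [h] at h0
  have h1 : ∑ i, (x i - x' i) * (x i + ∑ j, c i j (x i - x j) -
      (x' i + ∑ j, c i j (x' i - x' j))) = ∑ i, (x i - x' i) ^ 2 +
      ∑ i, (x i - x' i) * ∑ j, (c i j (x i - x j) - c i j (x' i - x' j)) := by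
    rw [← Finset.sum_add_distrib]
    refine Finset.sum_congr rfl fun i _ => ?_
    rw [Finset.sum_sub_distrib]; ring
  rw [h1]
  linarith

/-- `(x, θ) ↦ (y, θ)`. -/
noncomputable def toYTheta {N : ℕ} (ψ : ℝ → ℝ → ℝ) (q : Phase N) : Phase N := (betheY ψ q.1 q.2, q.2)

/-- `(x, θ) ↦ (x, p)`. -/
noncomputable def toXP {N : ℕ} (ψ : ℝ → ℝ → ℝ) (q : Phase N) : Phase N := (q.1, betheP ψ q.1 q.2)

/-- `ω⁻¹ : (x, p) ↦ (y, θ)`. -/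
noncomputable def omegaInv {N : ℕ} (ψ : ℝ → ℝ → ℝ) : Phase N → Phase N :=
  Function.invFun (omega ψ)

/-- The symplectic form on the tangent space `ℝ^{2N}`. -/
noncomputable def sform {N : ℕ} (a b : Phase N) : ℝ := ∑ i, (a.1 i * b.2 i - a.2 i * b.1 i)

/-- The Hamiltonian vector field of `f`. -/
noncomputable def hamField {N : ℕ} (f : Phase N → ℝ) (z : Phase N) : Phase N :=
  (fun i => dMom i f z, fun i => -dPos i f z)

/-- The generating function of `ω`, as a function of `(x, θ)`. -/
noncomputable def generating {N : ℕ} (ψ : ℝ → ℝ → ℝ) (q : Phase N) : ℝ :=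
  ∑ i, q.1 i * q.2 i + (1 / 2) * ∑ i, ∑ j, ψ (q.1 i - q.1 j) (q.2 i - q.2 j)

theorem hasFDerivAt_fst_apply {N : ℕ} (i : Fin N) (z : Phase N) :
    HasFDerivAt (fun z : Phase N => z.1 i) ((ContinuousLinearMap.proj (R := ℝ) i).comp
      (ContinuousLinearMap.fst ℝ (Fin N → ℝ) (Fin N → ℝ))) z :=
  ((ContinuousLinearMap.proj (R := ℝ) i).comp
    (ContinuousLinearMap.fst ℝ (Fin N → ℝ) (Fin N → ℝ))).hasFDerivAt

theorem hasFDerivAt_snd_apply {N : ℕ} (i : Fin N) (z : Phase N) :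
    HasFDerivAt (fun z : Phase N => z.2 i) ((ContinuousLinearMap.proj (R := ℝ) i).comp
      (ContinuousLinearMap.snd ℝ (Fin N → ℝ) (Fin N → ℝ))) z :=
  ((ContinuousLinearMap.proj (R := ℝ) i).comp
    (ContinuousLinearMap.snd ℝ (Fin N → ℝ) (Fin N → ℝ))).hasFDerivAt

namespace IsBetheKernel

variable {ψ : ℝ → ℝ → ℝ} {ε : ℝ} {N : ℕ}

/-- The diagonal term vanishes because `ψ_θ` is odd; sums over all `j` suit symmetrisation and
re-labelling. -/
theorem betheY_eq (h : IsBetheKernel ψ ε) (x θ : Fin N → ℝ) (i : Fin N) :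
    betheY ψ x θ i = x i + ∑ j, psiTheta ψ (x i - x j) (θ i - θ j) := by
  rw [betheY, Finset.sum_erase]
  rw [sub_self, sub_self, h.psiTheta_zero]

theorem betheP_eq (h : IsBetheKernel ψ ε) (x θ : Fin N → ℝ) (i : Fin N) :
    betheP ψ x θ i = θ i + ∑ j, psiX ψ (x i - x j) (θ i - θ j) := by
  rw [betheP, Finset.sum_erase]
  rw [sub_self, sub_self, h.psiX_zero]

theorem contDiff_betheY (h : IsBetheKernel ψ ε) :
    ContDiff ℝ 1 fun q : Phase N => betheY ψ q.1 q.2 := by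
  refine contDiff_pi.2 fun i => ?_
  refine ContDiff.add (by fun_prop) (ContDiff.sum fun j _ => ?_)
  exact h.contDiff_psiTheta.comp
    (f := fun q : Phase N => (q.1 i - q.1 j, q.2 i - q.2 j)) (by fun_prop)

theorem contDiff_betheP (h : IsBetheKernel ψ ε) :
    ContDiff ℝ 1 fun q : Phase N => betheP ψ q.1 q.2 := by
  refine contDiff_pi.2 fun i => ?_
  refine ContDiff.add (by fun_prop) (ContDiff.sum fun j _ => ?_)
  exact h.contDiff_psiX.comp
    (f := fun q : Phase N => (q.1 i - q.1 j, q.2 i - q.2 j)) (by fun_prop)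

theorem stronglyMonotone_betheY (h : IsBetheKernel ψ ε) (θ : Fin N → ℝ) :
    StronglyMonotone fun x => betheY ψ x θ := by
  have := stronglyMonotone_add_pair (c := fun i j s => psiTheta ψ s (θ i - θ j))
    (fun i j => h.psiTheta_mono _) fun i j s => by
      rw [← h.psiTheta_neg, neg_sub]
  simpa only [← h.betheY_eq] using this

theorem stronglyMonotone_betheP (h : IsBetheKernel ψ ε) (x : Fin N → ℝ) :
    StronglyMonotone fun θ => betheP ψ x θ := by
  have := stronglyMonotone_add_pair (c := fun i j s => psiX ψ (x i - x j) s)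
    (fun i j => h.psiX_mono _) fun i j s => by
      rw [← h.psiX_neg, neg_sub]
  simpa only [← h.betheP_eq] using this

theorem isC1Diffeo_betheY (h : IsBetheKernel ψ ε) (θ : Fin N → ℝ) :
    IsC1Diffeo fun x => betheY ψ x θ :=
  (h.stronglyMonotone_betheY θ).isC1Diffeo
    (h.contDiff_betheY.comp (contDiff_id.prodMk contDiff_const))

theorem isC1Diffeo_betheP (h : IsBetheKernel ψ ε) (x : Fin N → ℝ) :
    IsC1Diffeo fun θ => betheP ψ x θ :=
  (h.stronglyMonotone_betheP x).isC1Diffeo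
    (h.contDiff_betheP.comp (contDiff_const.prodMk contDiff_id))

theorem isC1Diffeo_toYTheta (h : IsBetheKernel ψ ε) :
    IsC1Diffeo (toYTheta ψ : Phase N → Phase N) :=
  isC1Diffeo_fiberwise h.contDiff_betheY h.stronglyMonotone_betheY

theorem isC1Diffeo_toXP (h : IsBetheKernel ψ ε) :
    IsC1Diffeo (toXP ψ : Phase N → Phase N) :=
  isC1Diffeo_swap.comp ((isC1Diffeo_fiberwise (g := fun q : Phase N => betheP ψ q.2 q.1)
    (h.contDiff_betheP.comp (contDiff_snd.prodMk contDiff_fst))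
    h.stronglyMonotone_betheP).comp isC1Diffeo_swap)

theorem betheY_solveX (h : IsBetheKernel ψ ε) (θ y : Fin N → ℝ) :
    betheY ψ (solveX ψ θ y) θ = y :=
  Function.rightInverse_invFun (h.isC1Diffeo_betheY θ).bijective.surjective y

theorem solveX_betheY (h : IsBetheKernel ψ ε) (θ x : Fin N → ℝ) :
    solveX ψ θ (betheY ψ x θ) = x :=
  Function.leftInverse_invFun (h.isC1Diffeo_betheY θ).bijective.injective x

theorem betheEquations_iff (h : IsBetheKernel ψ ε) (w z : Phase N) :
    BetheEquations ψ w z ↔ z = omega ψ w := by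
  constructor
  · rintro ⟨h1, h2⟩
    rw [omega, h1, h.solveX_betheY]
    exact Prod.ext rfl h2
  · rintro rfl
    exact ⟨(h.betheY_solveX _ _).symm, rfl⟩

theorem omega_toYTheta (h : IsBetheKernel ψ ε) (q : Phase N) :
    omega ψ (toYTheta ψ q) = toXP ψ q :=
  ((h.betheEquations_iff _ _).1 ⟨rfl, rfl⟩).symm

theorem isC1Diffeo_omega (h : IsBetheKernel ψ ε) :
    IsC1Diffeo (omega ψ : Phase N → Phase N) := by
  have hr := Function.rightInverse_surjInv (h.isC1Diffeo_toYTheta (N := N)).bijective.surjective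
  convert h.isC1Diffeo_toXP.comp (h.isC1Diffeo_toYTheta.of_rightInverse hr) using 1
  funext w
  rw [Function.comp_apply, ← h.omega_toYTheta, hr]

theorem omega_omegaInv (h : IsBetheKernel ψ ε) (z : Phase N) : omega ψ (omegaInv ψ z) = z :=
  Function.rightInverse_invFun h.isC1Diffeo_omega.bijective.surjective z

theorem omegaInv_omega (h : IsBetheKernel ψ ε) (w : Phase N) : omegaInv ψ (omega ψ w) = w :=
  Function.leftInverse_invFun h.isC1Diffeo_omega.bijective.injective w

theorem isC1Diffeo_omegaInv (h : IsBetheKernel ψ ε) :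
    IsC1Diffeo (omegaInv ψ : Phase N → Phase N) :=
  h.isC1Diffeo_omega.of_rightInverse h.omega_omegaInv

theorem contDiff_theta (h : IsBetheKernel ψ ε) :
    ContDiff ℝ 1 (theta ψ : Phase N → Fin N → ℝ) :=
  h.isC1Diffeo_omegaInv.contDiff.snd

theorem theta_omega (h : IsBetheKernel ψ ε) (w : Phase N) : theta ψ (omega ψ w) = w.2 :=
  congrArg Prod.snd (h.omegaInv_omega w)

theorem betheP_theta (h : IsBetheKernel ψ ε) (z : Phase N) :
    betheP ψ z.1 (theta ψ z) = z.2 :=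
  ((h.betheEquations_iff _ _).2 (h.omega_omegaInv z).symm).2.symm

/-- This characterises `theta` by its equation: permutation invariance, cluster locality and the
one-particle case all follow by exhibiting a solution. -/
theorem eq_betheP_iff (h : IsBetheKernel ψ ε) (x p θ : Fin N → ℝ) :
    p = betheP ψ x θ ↔ θ = theta ψ (x, p) := by
  have h1 := h.betheP_theta (x, p)
  constructor
  · rintro rfl
    exact (h.stronglyMonotone_betheP x).injective h1.symm
  · rintro rfl
    exact h1.symm

theorem isC1Diffeo_omega_fst (h : IsBetheKernel ψ ε) (θ : Fin N → ℝ) :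
    IsC1Diffeo fun y : Fin N → ℝ => (omega ψ (y, θ)).1 :=
  (h.isC1Diffeo_betheY θ).of_rightInverse (h.betheY_solveX θ)

theorem isC1Diffeo_theta (h : IsBetheKernel ψ ε) (x : Fin N → ℝ) :
    IsC1Diffeo fun p : Fin N → ℝ => theta ψ (x, p) :=
  (h.isC1Diffeo_betheP x).of_rightInverse fun p => h.betheP_theta (x, p)

/-! ### `ω` is canonical -/

theorem hasFDerivAt_generating (h : IsBetheKernel ψ ε) (q : Phase N) :
    HasFDerivAt (generating ψ)
      (∑ i, (betheP ψ q.1 q.2 i • (ContinuousLinearMap.proj (R := ℝ) i).comp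
          (ContinuousLinearMap.fst ℝ (Fin N → ℝ) (Fin N → ℝ)) +
        betheY ψ q.1 q.2 i • (ContinuousLinearMap.proj (R := ℝ) i).comp
          (ContinuousLinearMap.snd ℝ (Fin N → ℝ) (Fin N → ℝ)))) q := by
  have h1 := fun i => hasFDerivAt_fst_apply i q
  have h2 := fun i => hasFDerivAt_snd_apply i q
  have h3 : ∀ i j : Fin N, HasFDerivAt
      (fun q : Phase N => ψ (q.1 i - q.1 j) (q.2 i - q.2 j)) _ q := fun i j =>
    (h.hasFDerivAt (q.1 i - q.1 j, q.2 i - q.2 j)).comp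
      (f := fun q : Phase N => (q.1 i - q.1 j, q.2 i - q.2 j)) q
      (((h1 i).sub (h1 j)).prodMk ((h2 i).sub (h2 j)))
  refine ((HasFDerivAt.fun_sum fun i (_ : i ∈ Finset.univ) => (h1 i).mul (h2 i)).add
    ((HasFDerivAt.fun_sum fun i (_ : i ∈ Finset.univ) =>
      HasFDerivAt.fun_sum fun j (_ : j ∈ Finset.univ) => h3 i j).const_mul
        (1 / 2))).congr_fderiv ?_
  refine ContinuousLinearMap.ext fun v => ?_
  -- The factor 2 from symmetrisation cancels the `1 / 2` in `generating`.
  have e1 := sum_antisymm_mul_sub (c := fun i j => psiX ψ (q.1 i - q.1 j) (q.2 i - q.2 j))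
    (fun i j => by rw [← h.psiX_neg, neg_sub, neg_sub]) v.1
  have e2 := sum_antisymm_mul_sub (c := fun i j => psiTheta ψ (q.1 i - q.1 j) (q.2 i - q.2 j))
    (fun i j => by rw [← h.psiTheta_neg, neg_sub, neg_sub]) v.2
  simp only [_root_.add_apply, _root_.sum_apply,
    _root_.smul_apply, ContinuousLinearMap.comp_apply,
    ContinuousLinearMap.prod_apply, _root_.sub_apply,
    ContinuousLinearMap.proj_apply, ContinuousLinearMap.coe_fst', ContinuousLinearMap.coe_snd',
    smul_eq_mul, h.fderiv_apply, h.betheP_eq, h.betheY_eq, Finset.sum_add_distrib, add_mul]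
  rw [e1, e2]
  simp only [mul_comm (v.1 _), mul_comm (v.2 _)]
  ring

/-- The gradient of `generating` is `(p, y)`, which is `C¹`, so this is the symmetry of its second
derivative. It is the symplectic identity written in `(x, θ)`. -/
theorem generating_symm (h : IsBetheKernel ψ ε) (q a b : Phase N) :
    ∑ i, (b.1 i * fderiv ℝ (fun q : Phase N => betheP ψ q.1 q.2) q a i +
      b.2 i * fderiv ℝ (fun q : Phase N => betheY ψ q.1 q.2) q a i) =
    ∑ i, (a.1 i * fderiv ℝ (fun q : Phase N => betheP ψ q.1 q.2) q b i +
      a.2 i * fderiv ℝ (fun q : Phase N => betheY ψ q.1 q.2) q b i) := by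
  have hP : ∀ i, HasFDerivAt (fun q : Phase N => betheP ψ q.1 q.2 i) _ q := fun i =>
    hasFDerivAt_pi'.1 (h.contDiff_betheP.differentiable one_ne_zero q).hasFDerivAt i
  have hY : ∀ i, HasFDerivAt (fun q : Phase N => betheY ψ q.1 q.2 i) _ q := fun i =>
    hasFDerivAt_pi'.1 (h.contDiff_betheY.differentiable one_ne_zero q).hasFDerivAt i
  have hx := HasFDerivAt.fun_sum fun i (_ : i ∈ Finset.univ) =>
    ((hP i).smul_const ((ContinuousLinearMap.proj (R := ℝ) i).comp
          (ContinuousLinearMap.fst ℝ (Fin N → ℝ) (Fin N → ℝ)))).add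
    ((hY i).smul_const ((ContinuousLinearMap.proj (R := ℝ) i).comp
          (ContinuousLinearMap.snd ℝ (Fin N → ℝ) (Fin N → ℝ))))
  have := second_derivative_symmetric (fun q => h.hasFDerivAt_generating q) hx a b
  simpa [mul_comm] using this

end IsBetheKernel

/-! ### Hamiltonian vector fields -/

section HamField

variable {N : ℕ}

theorem fderiv_apply_eq_sum (f : Phase N → ℝ) (z v : Phase N) :
    fderiv ℝ f z v = ∑ i, (v.1 i * dPos i f z + v.2 i * dMom i f z) := by
  have h1 : v = ∑ i, (v.1 i • ((Pi.single i 1, 0) : Phase N) +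
      v.2 i • ((0, Pi.single i 1) : Phase N)) := by
    refine Prod.ext (funext fun k => ?_) (funext fun k => ?_)
    · simp [Prod.fst_sum, Finset.sum_apply, Pi.single_apply]
    · simp [Prod.snd_sum, Finset.sum_apply, Pi.single_apply]
  conv_lhs => rw [h1]
  simp only [map_sum, map_add, map_smul, smul_eq_mul, dPos, dMom]

theorem sform_hamField (f : Phase N → ℝ) (z v : Phase N) :
    sform (hamField f z) v = fderiv ℝ f z v := by
  rw [fderiv_apply_eq_sum, sform]
  exact Finset.sum_congr rfl fun i _ => by simp only [hamField]; ring

theorem poisson_eq_fderiv (f g : Phase N → ℝ) (z : Phase N) :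
    poisson f g z = fderiv ℝ f z (hamField g z) := by
  rw [fderiv_apply_eq_sum, poisson]
  exact Finset.sum_congr rfl fun i _ => by simp only [hamField]; ring

theorem sform_ext {a b : Phase N} (h : ∀ v, sform a v = sform b v) : a = b := by
  refine Prod.ext (funext fun k => ?_) (funext fun k => ?_)
  · simpa [sform, Pi.single_apply] using h (0, Pi.single k 1)
  · simpa [sform, Pi.single_apply] using h (Pi.single k 1, 0)

theorem isTrajectory_iff (H : Phase N → ℝ) (γ : ℝ → Phase N) :
    IsTrajectory H γ ↔ ∀ t, HasDerivAt γ (hamField H (γ t)) t := by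
  have h1 : ∀ i z, poisson (fun z : Phase N => z.1 i) H z = (hamField H z).1 i := fun i z => by
    rw [poisson_eq_fderiv, (hasFDerivAt_fst_apply i z).fderiv]; rfl
  have h2 : ∀ i z, poisson (fun z : Phase N => z.2 i) H z = (hamField H z).2 i := fun i z => by
    rw [poisson_eq_fderiv, (hasFDerivAt_snd_apply i z).fderiv]; rfl
  simp only [IsTrajectory, h1, h2]
  refine forall_congr' fun t => ?_
  constructor
  · intro h
    exact (hasDerivAt_pi.2 fun i => (h i).1).prodMk (hasDerivAt_pi.2 fun i => (h i).2)
  · intro h i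
    exact ⟨hasDerivAt_pi.1 (hasFDerivAt_fst.comp_hasDerivAt t h) i,
      hasDerivAt_pi.1 (hasFDerivAt_snd.comp_hasDerivAt t h) i⟩

/-- The Hamiltonian vector field of a function of the momenta only. -/
theorem hamField_comp_snd {f : (Fin N → ℝ) → ℝ} {z : Phase N}
    (hf : DifferentiableAt ℝ f z.2) : hamField (fun z : Phase N => f z.2) z =
      (fun i => fderiv ℝ f z.2 (Pi.single i 1), 0) := by
  have : HasFDerivAt (fun z : Phase N => f z.2) _ z := hf.hasFDerivAt.comp z hasFDerivAt_snd
  refine Prod.ext (funext fun i => ?_) (funext fun i => ?_)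
  · simp only [hamField, dMom, this.fderiv]; rfl
  · simp only [hamField, dPos, this.fderiv]; simp

theorem hasDerivAt_tau (w : Phase N) (t : ℝ) :
    HasDerivAt (fun s => tau s w) (w.2, 0) t := by
  refine HasDerivAt.prodMk (hasDerivAt_pi.2 fun i => ?_) (hasDerivAt_const t w.2)
  simpa using ((hasDerivAt_id t).const_mul (w.2 i)).const_add (w.1 i)

theorem contDiff_tau (w : Phase N) : ContDiff ℝ 1 fun t : ℝ => tau t w := by
  unfold tau; fun_prop

theorem tau_zero (w : Phase N) : tau 0 w = w := by simp [tau]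

theorem eq_tau_of_hasDerivAt {η : ℝ → Phase N} (hη : ∀ t, HasDerivAt η ((η t).2, 0) t) (t : ℝ) :
    η t = tau t (η 0) := by
  have h2 : ∀ t, (η t).2 = (η 0).2 := fun t => by
    have h : ∀ t, HasDerivAt (fun s => (η s).2) 0 t := fun t =>
      (hasFDerivAt_snd (𝕜 := ℝ) (p := η t)).comp_hasDerivAt t (hη t)
    exact is_const_of_deriv_eq_zero (fun t => (h t).differentiableAt) (fun t => (h t).deriv) t 0
  have h : ∀ t, HasDerivAt (fun s => η s - tau s (η 0)) 0 t := fun t => by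
    have := (hη t).sub (hasDerivAt_tau (η 0) t)
    rwa [h2 t, sub_self] at this
  have := is_const_of_deriv_eq_zero (fun t => (h t).differentiableAt) (fun t => (h t).deriv) t 0
  simpa [tau_zero, sub_eq_zero] using this

end HamField

/-! ### Transport of Hamiltonian vector fields by `ω`, and the flow of `H_ψ` -/

namespace IsBetheKernel

variable {ψ : ℝ → ℝ → ℝ} {ε : ℝ} {N : ℕ}

theorem fderiv_toYTheta (h : IsBetheKernel ψ ε) (q a : Phase N) :
    fderiv ℝ (toYTheta ψ) q a = (fderiv ℝ (fun q : Phase N => betheY ψ q.1 q.2) q a, a.2) := by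
  have : HasFDerivAt (toYTheta ψ) _ q :=
    (h.contDiff_betheY.differentiable one_ne_zero q).hasFDerivAt.prodMk hasFDerivAt_snd
  rw [this.fderiv]; rfl

theorem fderiv_toXP (h : IsBetheKernel ψ ε) (q a : Phase N) :
    fderiv ℝ (toXP ψ) q a = (a.1, fderiv ℝ (fun q : Phase N => betheP ψ q.1 q.2) q a) := by
  have : HasFDerivAt (toXP ψ) _ q :=
    hasFDerivAt_fst.prodMk (h.contDiff_betheP.differentiable one_ne_zero q).hasFDerivAt
  rw [this.fderiv]; rfl

theorem hasFDerivAt_omega (h : IsBetheKernel ψ ε) (w : Phase N) :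
    HasFDerivAt (omega ψ) (fderiv ℝ (omega ψ) w) w :=
  (h.isC1Diffeo_omega.contDiff.differentiable one_ne_zero w).hasFDerivAt

theorem hasFDerivAt_omegaInv (h : IsBetheKernel ψ ε) (z : Phase N) :
    HasFDerivAt (omegaInv ψ) (fderiv ℝ (omegaInv ψ) z) z :=
  (h.isC1Diffeo_omegaInv.contDiff.differentiable one_ne_zero z).hasFDerivAt

theorem fderiv_omegaInv_omega (h : IsBetheKernel ψ ε) (w v : Phase N) :
    fderiv ℝ (omegaInv ψ) (omega ψ w) (fderiv ℝ (omega ψ) w v) = v := by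
  have h1 := (h.hasFDerivAt_omegaInv (omega ψ w)).comp w (h.hasFDerivAt_omega w)
  rw [show omegaInv ψ ∘ omega ψ = id from funext h.omegaInv_omega] at h1
  exact DFunLike.congr_fun (h1.unique (hasFDerivAt_id w)) v

theorem fderiv_omega_omegaInv (h : IsBetheKernel ψ ε) (w v : Phase N) :
    fderiv ℝ (omega ψ) w (fderiv ℝ (omegaInv ψ) (omega ψ w) v) = v := by
  have h0 := h.hasFDerivAt_omega (omegaInv ψ (omega ψ w))
  have h1 := h0.comp (omega ψ w) (h.hasFDerivAt_omegaInv (omega ψ w))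
  rw [show omega ψ ∘ omegaInv ψ = id from funext h.omega_omegaInv, h.omegaInv_omega] at h1
  exact DFunLike.congr_fun (h1.unique (hasFDerivAt_id _)) v

/-- `ω` is a symplectic map. -/
theorem sform_fderiv_omega (h : IsBetheKernel ψ ε) (w a b : Phase N) :
    sform (fderiv ℝ (omega ψ) w a) (fderiv ℝ (omega ψ) w b) = sform a b := by
  have hA := h.isC1Diffeo_toYTheta (N := N)
  obtain ⟨q, rfl⟩ := hA.bijective.surjective w
  have hcomp : ∀ v, fderiv ℝ (omega ψ) (toYTheta ψ q) (fderiv ℝ (toYTheta ψ) q v) =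
      fderiv ℝ (toXP ψ) q v := fun v => by
    have h1 := (h.hasFDerivAt_omega (toYTheta ψ q)).comp q
      (hA.contDiff.differentiable one_ne_zero q).hasFDerivAt
    rw [show omega ψ ∘ toYTheta ψ = toXP ψ from funext h.omega_toYTheta] at h1
    rw [h1.fderiv]; rfl
  -- Every tangent vector at `(y, θ)` comes from one at `(x, θ)`, so the identity may be checked in
  -- the mixed coordinates.
  have hsurj : ∀ v, ∃ u, fderiv ℝ (toYTheta ψ) q u = v := fun v => by
    obtain ⟨g, hg⟩ : ∃ g : Phase N → Phase N, ∀ y, toYTheta ψ (g y) = y :=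
      ⟨_, Function.rightInverse_surjInv hA.bijective.surjective⟩
    have hgq : g (toYTheta ψ q) = q := hA.bijective.injective (hg _)
    have h1 : HasFDerivAt (toYTheta ψ) _ (g (toYTheta ψ q)) :=
      (hA.contDiff.differentiable one_ne_zero _).hasFDerivAt
    have h2 := h1.comp (toYTheta ψ q)
      ((hA.contDiff_of_rightInverse hg).differentiable one_ne_zero _).hasFDerivAt
    rw [show toYTheta ψ ∘ g = id from funext hg, hgq] at h2
    exact ⟨_, DFunLike.congr_fun (h2.unique (hasFDerivAt_id _)) v⟩
  obtain ⟨a, rfl⟩ := hsurj a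
  obtain ⟨b, rfl⟩ := hsurj b
  have hs := h.generating_symm q a b
  rw [hcomp, hcomp, h.fderiv_toYTheta, h.fderiv_toYTheta, h.fderiv_toXP, h.fderiv_toXP]
  simp only [sform, Finset.sum_add_distrib, Finset.sum_sub_distrib] at hs ⊢
  simp only [mul_comm (b.1 _), mul_comm (b.2 _), mul_comm (a.1 _), mul_comm (a.2 _)] at hs ⊢
  linarith

/-- A Hamiltonian vector field is determined by pairing it with all vectors under the non-degenerate
form `sform`, which `ω` preserves. -/
theorem fderiv_omega_hamField (h : IsBetheKernel ψ ε) {f : Phase N → ℝ} {w : Phase N}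
    (hf : DifferentiableAt ℝ f (omega ψ w)) :
    fderiv ℝ (omega ψ) w (hamField (f ∘ omega ψ) w) = hamField f (omega ψ w) := by
  refine sform_ext fun v => ?_
  rw [← h.fderiv_omega_omegaInv w v, h.sform_fderiv_omega, sform_hamField, sform_hamField,
    (hf.hasFDerivAt.comp w (h.hasFDerivAt_omega w)).fderiv]
  rfl

/-- In the coordinates `(y, θ)` the Hamiltonian field of a function of `θ` points along `y`, where
functions of `θ` do not vary. -/
theorem poisson_comp_theta (h : IsBetheKernel ψ ε) {f g : (Fin N → ℝ) → ℝ}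
    (hf : Differentiable ℝ f) (hg : Differentiable ℝ g) (z : Phase N) :
    poisson (fun z => f (theta ψ z)) (fun z => g (theta ψ z)) z = 0 := by
  obtain ⟨w, rfl⟩ := h.isC1Diffeo_omega.bijective.surjective z
  have hθ : Differentiable ℝ (theta ψ : Phase N → Fin N → ℝ) :=
    h.contDiff_theta.differentiable one_ne_zero
  have hc : ∀ k : (Fin N → ℝ) → ℝ,
      (fun z => k (theta ψ z)) ∘ omega ψ = fun w : Phase N => k w.2 := fun k =>
    funext fun w => congrArg k (h.theta_omega w)
  have hF : DifferentiableAt ℝ (fun z : Phase N => f (theta ψ z)) (omega ψ w) :=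
    (hf.comp hθ) _
  have hG : DifferentiableAt ℝ (fun z : Phase N => g (theta ψ z)) (omega ψ w) :=
    (hg.comp hθ) _
  have h1 := (hF.hasFDerivAt.comp w (h.hasFDerivAt_omega w)).fderiv
  have h2 : HasFDerivAt (fun w : Phase N => f w.2) _ w :=
    (hf w.2).hasFDerivAt.comp w hasFDerivAt_snd
  rw [poisson_eq_fderiv, ← h.fderiv_omega_hamField hG, ← ContinuousLinearMap.comp_apply, ← h1, hc, hc, hamField_comp_snd (hg _), h2.fderiv]
  simp

theorem differentiable_sum_sq : Differentiable ℝ fun θ : Fin N → ℝ => ∑ i, θ i ^ 2 / 2 := by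
  fun_prop

theorem contDiff_Hpsi (h : IsBetheKernel ψ ε) : ContDiff ℝ 1 (Hpsi ψ N) := by
  have := h.contDiff_theta (N := N)
  unfold Hpsi
  fun_prop

theorem contDiff_charge (h : IsBetheKernel ψ ε) (a : ℕ) : ContDiff ℝ 1 (charge ψ a N) := by
  have := h.contDiff_theta (N := N)
  unfold charge
  fun_prop

theorem poisson_charge (h : IsBetheKernel ψ ε) (a b : ℕ) (z : Phase N) :
    poisson (charge ψ a N) (charge ψ b N) z = 0 :=
  h.poisson_comp_theta (f := fun θ => ∑ i, θ i ^ a) (g := fun θ => ∑ i, θ i ^ b)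
    (by fun_prop) (by fun_prop) z

theorem hamField_Hpsi_omega (h : IsBetheKernel ψ ε) (w : Phase N) :
    hamField (Hpsi ψ N) (omega ψ w) = fderiv ℝ (omega ψ) w (w.2, 0) := by
  rw [← h.fderiv_omega_hamField (h.contDiff_Hpsi.differentiable one_ne_zero _)]
  have hc : Hpsi ψ N ∘ omega ψ = fun w : Phase N => ∑ i, w.2 i ^ 2 / 2 :=
    funext fun w => by simp only [Function.comp_apply, Hpsi, h.theta_omega]
  rw [hc, hamField_comp_snd (f := fun θ : Fin N → ℝ => ∑ i, θ i ^ 2 / 2)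
    (differentiable_sum_sq _)]
  congr 2
  funext k
  have : HasFDerivAt (fun θ : Fin N → ℝ => ∑ i, θ i ^ 2 / 2)
      (∑ i, w.2 i • ContinuousLinearMap.proj (R := ℝ) (φ := fun _ : Fin N => ℝ) i) w.2 := by
    refine HasFDerivAt.fun_sum fun i _ => ?_
    have h1 : HasFDerivAt (fun θ : Fin N → ℝ => θ i) _ w.2 :=
      (ContinuousLinearMap.proj (R := ℝ) (φ := fun _ : Fin N => ℝ) i).hasFDerivAt
    have h2 : HasDerivAt (fun s : ℝ => s ^ 2 / 2) (w.2 i) (w.2 i) := by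
      have := (hasDerivAt_pow 2 (w.2 i)).div_const 2
      simpa using this
    exact h2.comp_hasFDerivAt w.2 h1
  rw [this.fderiv]
  simp [Pi.single_apply]

/-- The solutions of Hamilton's equations for `H_ψ` are the images of free trajectories. -/
theorem isTrajectory_Hpsi_iff (h : IsBetheKernel ψ ε) (γ : ℝ → Phase N) :
    IsTrajectory (Hpsi ψ N) γ ↔ ∀ t, γ t = omega ψ (tau t (omegaInv ψ (γ 0))) := by
  rw [isTrajectory_iff]
  constructor
  · intro hγ t
    -- The Hamiltonian is only shown to be `C¹`, so no Lipschitz bound on its field is at hand;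
    -- uniqueness comes from pulling the solution back to the free equation.
    have hη : ∀ t, HasDerivAt (fun s => omegaInv ψ (γ s)) ((omegaInv ψ (γ t)).2, 0) t := by
      intro t
      have h1 := (h.hasFDerivAt_omegaInv (γ t)).comp_hasDerivAt t (hγ t)
      have h2 := h.hamField_Hpsi_omega (omegaInv ψ (γ t))
      have h3 := h.fderiv_omegaInv_omega (omegaInv ψ (γ t)) ((omegaInv ψ (γ t)).2, 0)
      rw [h.omega_omegaInv] at h2 h3
      rwa [h2, h3] at h1
    rw [← eq_tau_of_hasDerivAt hη t, h.omega_omegaInv]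
  · intro hγ t
    have h1 := (h.hasFDerivAt_omega (tau t (omegaInv ψ (γ 0)))).comp_hasDerivAt t
      (hasDerivAt_tau (omegaInv ψ (γ 0)) t)
    have h2 := h.hamField_Hpsi_omega (tau t (omegaInv ψ (γ 0)))
    rw [← hγ t] at h2
    rw [h2]
    exact h1.congr_of_eventuallyEq (Eventually.of_forall hγ)

theorem isTrajectory_omega_tau (h : IsBetheKernel ψ ε) (w : Phase N) :
    IsTrajectory (Hpsi ψ N) fun t => omega ψ (tau t w) := by
  rw [h.isTrajectory_Hpsi_iff]
  intro t
  rw [h.omegaInv_omega, tau_zero]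

/-- The time evolution generated by `H_ψ`. -/
theorem isHamiltonianFlow (h : IsBetheKernel ψ ε) :
    IsHamiltonianFlow (Hpsi ψ N) fun t z => omega ψ (tau t (omegaInv ψ z)) := by
  intro z γ
  constructor
  · rintro ⟨hγ, rfl⟩
    exact funext ((h.isTrajectory_Hpsi_iff γ).1 hγ)
  · rintro rfl
    exact ⟨h.isTrajectory_omega_tau _, by simp only [tau_zero, h.omega_omegaInv]⟩

end IsBetheKernel

/-! ### Functional independence of the power sums -/

section PowerSums

variable {N : ℕ}

/-- Momenta that are pairwise distinct and non-zero. -/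
def regularMomenta (N : ℕ) : Set (Fin N → ℝ) :=
  {p | (∀ i, p i ≠ 0) ∧ ∀ i j, i ≠ j → p i ≠ p j}

theorem dense_regularMomenta : Dense (regularMomenta N) := by
  -- One non-zero linear form for each excluded hyperplane: diagonal indices encode `p_i = 0`, the
  -- others `p_i = p_j`.
  let l : Fin N × Fin N → (Fin N → ℝ) →ₗ[ℝ] ℝ := fun q =>
    if q.1 = q.2 then LinearMap.proj (R := ℝ) (φ := fun _ : Fin N => ℝ) q.1 else
      LinearMap.proj (R := ℝ) (φ := fun _ : Fin N => ℝ) q.1 -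
        LinearMap.proj (R := ℝ) (φ := fun _ : Fin N => ℝ) q.2
  have hl : ∀ q, l q (Pi.single q.1 1) = 1 := fun q => by
    by_cases h : q.1 = q.2
    · simp [l, h]
    · simp [l, h, Ne.symm h]
  have hc : ∀ q, Continuous (l q) := fun q => LinearMap.continuous_of_finiteDimensional _
  have hd : Dense (⋂ q, {p | l q p ≠ 0}) := by
    refine dense_iInter_of_isOpen (fun q => isOpen_ne_fun (hc q) continuous_const) fun q => ?_
    have hs : Function.Surjective (l q) := fun c =>
      ⟨c • Pi.single q.1 1, by rw [map_smul, hl, smul_eq_mul, mul_one]⟩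
    exact (dense_compl_singleton (0 : ℝ)).preimage (LinearMap.isOpenMap_of_finiteDimensional _ hs)
  refine hd.mono fun p hp => ?_
  rw [Set.mem_iInter] at hp
  refine ⟨fun i => by simpa [l] using hp (i, i), fun i j hij => ?_⟩
  simpa [l, hij, sub_eq_zero] using hp (i, j)

theorem fderiv_sum_pow_single (n : ℕ) (p : Fin N → ℝ) (j : Fin N) :
    fderiv ℝ (fun p : Fin N → ℝ => ∑ i, p i ^ n) p (Pi.single j 1) = n * p j ^ (n - 1) := by
  have : HasFDerivAt (fun p : Fin N → ℝ => ∑ i, p i ^ n) (∑ i, (n * p i ^ (n - 1)) •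
      ContinuousLinearMap.proj (R := ℝ) (φ := fun _ : Fin N => ℝ) i) p := by
    refine HasFDerivAt.fun_sum fun i _ => ?_
    have h1 : HasFDerivAt (fun p : Fin N → ℝ => p i) _ p :=
      (ContinuousLinearMap.proj (R := ℝ) (φ := fun _ : Fin N => ℝ) i).hasFDerivAt
    exact (hasDerivAt_pow n (p i)).comp_hasFDerivAt p h1
  rw [this.fderiv]
  simp [Pi.single_apply]

theorem differentiable_sum_pow (n : ℕ) :
    Differentiable ℝ fun p : Fin N → ℝ => ∑ i, p i ^ n := by
  fun_prop

/-- At a regular point, no non-trivial combination of the differentials of the power sums of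
degrees `k + 1, …, k + N` vanishes. -/
theorem coeff_eq_zero_of_regularMomenta (k : ℕ) {p : Fin N → ℝ} (hp : p ∈ regularMomenta N)
    {c : Fin N → ℝ}
    (hc : ∀ v, ∑ a, c a * fderiv ℝ (fun p : Fin N → ℝ => ∑ i, p i ^ ((a : ℕ) + 1 + k)) p v = 0) :
    c = 0 := by
  have hinj : Function.Injective p := fun i j hij => by
    by_contra hne
    exact hp.2 i j hne hij
  have h0 : (fun a : Fin N => c a * ((a : ℕ) + 1 + k : ℝ)) = 0 := by
    -- Vandermonde at the distinct nodes `p j`; the momenta must also be non-zero so that the common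
    -- factor `p j ^ k` can be cancelled.
    refine Matrix.eq_zero_of_forall_index_sum_mul_pow_eq_zero hinj fun j => ?_
    have h1 := hc (Pi.single j 1)
    simp only [fderiv_sum_pow_single] at h1
    have h2 : (∑ a : Fin N, c a * ((a : ℕ) + 1 + k : ℝ) * p j ^ (a : ℕ)) * p j ^ k = 0 := by
      rw [← h1, Finset.sum_mul]
      refine Finset.sum_congr rfl fun a _ => ?_
      rw [show (a : ℕ) + 1 + k - 1 = a + k by omega, pow_add]
      push_cast
      ring
    exact (mul_eq_zero.1 h2).resolve_right (pow_ne_zero _ (hp.1 j))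
  funext a
  refine (mul_eq_zero.1 (congrFun h0 a)).resolve_right ?_
  positivity

theorem functionallyIndependent_sum_pow (k : ℕ) :
    FunctionallyIndependent
      (fun (a : Fin N) (p : Fin N → ℝ) => ∑ i, p i ^ ((a : ℕ) + 1 + k)) := by
  refine dense_regularMomenta.mono fun p hp => ?_
  refine Fintype.linearIndependent_iff.2 fun c hc => congrFun ?_
  refine coeff_eq_zero_of_regularMomenta k hp fun v => ?_
  have := DFunLike.congr_fun hc v
  simpa using this

theorem FunctionallyIndependent.not_const {ι E : Type*} [NormedAddCommGroup E] [NormedSpace ℝ E]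
    {f : ι → E → ℝ} (hf : FunctionallyIndependent f) (a : ι) : ¬ ∃ k : ℝ, ∀ z, f a z = k := by
  rintro ⟨k, hk⟩
  obtain ⟨z, hz⟩ := Dense.nonempty hf
  refine LinearIndependent.ne_zero a hz ?_
  rw [show f a = fun _ => k from funext hk]
  exact fderiv_const_apply k

end PowerSums

/-! ### Clusters -/

section Clusters

variable {N : ℕ} {ε : ℝ}

theorem lt_abs_sub_of_mem_clusters {x : Fin N → ℝ} {I : Finset (Fin N)}
    (hI : I ∈ clusters ε x) {i j : Fin N} (hi : i ∉ I) (hj : j ∈ I) : ε < |x i - x j| := by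
  classical
  by_contra hle
  rw [not_lt, abs_sub_comm] at hle
  refine hi ?_
  rw [clusters] at hI
  rw [← Finpartition.part_eq_of_mem _ hI hj, Finpartition.mem_part_ofSetoid_iff_rel]
  exact Relation.EqvGen.rel _ _ hle

theorem sum_clusters (x f : Fin N → ℝ) : ∑ I ∈ clusters ε x, ∑ i ∈ I, f i = ∑ i, f i := by
  classical
  have hd := Finpartition.disjoint (Finpartition.ofSetoid
    (Relation.EqvGen.setoid (fun i j : Fin N => |x i - x j| ≤ ε)))
  have h := Finset.sum_biUnion (f := f) hd
  rw [Finpartition.biUnion_parts] at h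
  exact h.symm

theorem sum_orderEmbOfFin (J : Finset (Fin N)) (f : Fin N → ℝ) :
    ∑ r : Fin J.card, f (J.orderEmbOfFin rfl r) = ∑ i ∈ J, f i := by
  conv_rhs => rw [← Finset.map_orderEmbOfFin_univ J rfl, Finset.sum_map]
  rfl

end Clusters

/-- The constant term at large times of the position of a particle on the trajectory with
parameters `w = (y, θ)`: the outgoing one for `s = ε`, the incoming one for `s = -ε`. -/
noncomputable def impact {N : ℕ} (ψ : ℝ → ℝ → ℝ) (s : ℝ) (w : Phase N) (i : Fin N) : ℝ :=
  w.1 i - ∑ j, psiTheta ψ (s * Real.sign (w.2 i - w.2 j)) (w.2 i - w.2 j)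

theorem impact_tau {N : ℕ} (ψ : ℝ → ℝ → ℝ) (s t : ℝ) (w : Phase N) (i : Fin N) :
    impact ψ s (tau t w) i = w.2 i * t + impact ψ s w i := by
  simp only [impact, tau]; ring

namespace IsBetheKernel

variable {ψ : ℝ → ℝ → ℝ} {ε : ℝ} {N : ℕ}

/-! ### The charges -/

/-- The map `theta` is open with surjective derivative, so density and independence pull back from
the power sums. The shift `k` is 0 for the charges from degree 1 on, and 1 for those from degree 2
on. -/
theorem functionallyIndependent_charge (h : IsBetheKernel ψ ε) (k : ℕ) :
    FunctionallyIndependent (fun a : Fin N => charge ψ ((a : ℕ) + 1 + k) N) := by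
  have hopen : IsOpenMap (theta ψ : Phase N → Fin N → ℝ) := by
    obtain ⟨e, he, h1, h2⟩ := h.isC1Diffeo_omegaInv (N := N)
    have : IsOpenMap e := (e.toHomeomorph (fun s => ⟨fun hs => by
      have := hs.preimage h2.continuous
      rwa [← Set.preimage_comp, Equiv.self_comp_symm] at this, fun hs =>
      hs.preimage h1.continuous⟩)).isOpenMap
    have h3 := isOpenMap_snd.comp this
    rwa [show Prod.snd ∘ e = theta ψ from funext fun z => congrArg Prod.snd (he z)] at h3
  refine (dense_regularMomenta.preimage hopen).mono fun z hz => ?_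
  refine Fintype.linearIndependent_iff.2 fun c hc => congrFun ?_
  refine coeff_eq_zero_of_regularMomenta k hz fun v => ?_
  have hθ : HasFDerivAt (theta ψ) (fderiv ℝ (theta ψ) z) z :=
    (h.contDiff_theta.differentiable one_ne_zero z).hasFDerivAt
  have hv : ∃ u, fderiv ℝ (theta ψ) z u = v := by
    obtain ⟨w, rfl⟩ := h.isC1Diffeo_omega.bijective.surjective z
    have h1 := hθ.comp w (h.hasFDerivAt_omega w)
    rw [show theta ψ ∘ omega ψ = Prod.snd from funext h.theta_omega] at h1
    exact ⟨_, DFunLike.congr_fun (h1.unique hasFDerivAt_snd) (0, v)⟩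
  obtain ⟨u, rfl⟩ := hv
  have h2 := DFunLike.congr_fun hc u
  have h3 : ∀ a : Fin N, fderiv ℝ (charge ψ ((a : ℕ) + 1 + k) N) z =
      (fderiv ℝ (fun p : Fin N → ℝ => ∑ i, p i ^ ((a : ℕ) + 1 + k)) (theta ψ z)).comp
        (fderiv ℝ (theta ψ) z) := fun a =>
    HasFDerivAt.fderiv (((differentiable_sum_pow _ _).hasFDerivAt).comp z hθ)
  simpa [h3] using h2

theorem Hpsi_eq_charge (N : ℕ) (z : Phase N) : Hpsi ψ N z = (1 / 2 : ℝ) * charge ψ 2 N z := by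
  rw [Hpsi, charge, Finset.mul_sum]
  exact Finset.sum_congr rfl fun i _ => by ring

theorem Hpsi_eq_add_Vpsi (z : Phase N) : Hpsi ψ N z = ∑ i, z.2 i ^ 2 / 2 + Vpsi ψ N z := by
  rw [Hpsi, Vpsi, ← Finset.sum_add_distrib]
  exact Finset.sum_congr rfl fun i _ => by ring

theorem theta_comp_perm (h : IsBetheKernel ψ ε) (σ : Equiv.Perm (Fin N)) (z : Phase N) :
    theta ψ (z.1 ∘ σ, z.2 ∘ σ) = theta ψ z ∘ σ := by
  refine ((h.eq_betheP_iff _ _ _).1 (funext fun i => ?_)).symm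
  rw [Function.comp_apply, ← h.betheP_theta z, h.betheP_eq, h.betheP_eq]
  simp only [Function.comp_apply]
  rw [← Equiv.sum_comp σ]

theorem isManyParticleSystem_Hpsi (h : IsBetheKernel ψ ε) : IsManyParticleSystem (Hpsi ψ) := by
  refine fun N => ⟨h.contDiff_Hpsi, fun σ z => ?_⟩
  simp only [Hpsi, h.theta_comp_perm, Function.comp_apply]
  exact Equiv.sum_comp σ fun i => theta ψ z i ^ 2 / 2

/-- Particles outside `J` contribute nothing to the equations for `J`, as `ψ_x` vanishes at their
distance. So the restricted `θ` solves the smaller system, whose solution is unique. -/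
theorem theta_restrict (h : IsBetheKernel ψ ε) {J : Finset (Fin N)} {z : Phase N}
    (hJ : ∀ i ∉ J, ∀ j ∈ J, ε < |z.1 i - z.1 j|) (r : Fin J.card) :
    theta ψ z (J.orderEmbOfFin rfl r) = theta ψ (restrict J z) r := by
  refine congrFun (f := fun r => theta ψ z (J.orderEmbOfFin rfl r))
    ((h.eq_betheP_iff (restrict J z).1 (restrict J z).2 _).1 (funext fun r => ?_)) r
  have h1 := congrFun (h.betheP_theta z) (J.orderEmbOfFin rfl r)
  rw [h.betheP_eq] at h1 ⊢
  simp only [restrict]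
  rw [← h1, sum_orderEmbOfFin J fun j => psiX ψ (z.1 (J.orderEmbOfFin rfl r) - z.1 j)
    (theta ψ z (J.orderEmbOfFin rfl r) - theta ψ z j)]
  congr 1
  refine (Finset.sum_subset (Finset.subset_univ J) fun j _ hj => h.range _ _ ?_).symm
  rw [abs_sub_comm]
  exact (hJ j hj _ (Finset.orderEmbOfFin_mem J rfl r)).le

theorem theta_restrict_cluster (h : IsBetheKernel ψ ε) (z : Phase N) {I : Finset (Fin N)}
    (hI : I ∈ clusters ε z.1) (r : Fin I.card) :
    theta ψ z (I.orderEmbOfFin rfl r) = theta ψ (restrict I z) r :=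
  h.theta_restrict (fun _ hi _ hj => lt_abs_sub_of_mem_clusters hI hi hj) r

theorem theta_one (h : IsBetheKernel ψ ε) (z : Phase 1) : theta ψ z = z.2 := by
  refine ((h.eq_betheP_iff z.1 z.2 z.2).1 (funext fun i => ?_)).symm
  rw [betheP, Finset.sum_eq_zero, add_zero]
  intro j hj
  exact absurd (Subsingleton.elim j i) (Finset.ne_of_mem_erase hj)

theorem contDiff_sum_theta_sub (h : IsBetheKernel ψ ε) {E : ℝ → ℝ} (hE : ContDiff ℝ 1 E) :
    ContDiff ℝ 1 fun z : Phase N => ∑ i, (E (theta ψ z i) - E (z.2 i)) := by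
  have := h.contDiff_theta (N := N)
  fun_prop

theorem hasFiniteRange_sum_theta_sub (h : IsBetheKernel ψ ε) {E : ℝ → ℝ} (hE : ContDiff ℝ 1 E) :
    HasFiniteRange ε fun N (z : Phase N) => ∑ i, (E (theta ψ z i) - E (z.2 i)) := by
  refine ⟨fun n z => ∑ i, (E (theta ψ z i) - E (z.2 i)), fun n => h.contDiff_sum_theta_sub hE,
    fun z => by simp [h.theta_one], fun N z => ?_⟩
  refine (sum_clusters (ε := ε) z.1 _).symm.trans ?_
  refine Finset.sum_congr rfl fun I hI => ?_
  rw [← sum_orderEmbOfFin]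
  refine Finset.sum_congr rfl fun r _ => ?_
  rw [h.theta_restrict_cluster z hI, restrict]

theorem hasFiniteRange_Vpsi (h : IsBetheKernel ψ ε) : HasFiniteRange ε (Vpsi ψ) := by
  have := h.hasFiniteRange_sum_theta_sub (E := fun p => p ^ 2 / 2) (by fun_prop)
  simp only [← sub_div] at this
  exact this

theorem hasFiniteRangeInteraction_charge (h : IsBetheKernel ψ ε) (a : ℕ) :
    HasFiniteRangeInteraction ε (fun p => p ^ a) (charge ψ a) := by
  have hE : ContDiff ℝ 1 fun p : ℝ => p ^ a := by fun_prop
  refine ⟨_, fun N => h.contDiff_sum_theta_sub hE, fun N z => ?_,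
    h.hasFiniteRange_sum_theta_sub hE⟩
  rw [charge, Finset.sum_sub_distrib, add_sub_cancel]

theorem isFiniteRangeLiouvilleIntegrable (h : IsBetheKernel ψ ε) :
    IsFiniteRangeLiouvilleIntegrable ε (Hpsi ψ) := by
  -- Degrees start at 2 so that `H_ψ` is half the first charge, and is thus in the span of the first
  -- `N` charges even for `N = 1`.
  refine ⟨h.isManyParticleSystem_Hpsi, fun a p => p ^ (a + 2), fun a => charge ψ (a + 2),
    fun a => by fun_prop, fun N _ => functionallyIndependent_sum_pow 1, fun N hN => ?_,
    fun N a b => h.poisson_charge _ _, fun a => h.hasFiniteRangeInteraction_charge _⟩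
  have hi := h.functionallyIndependent_charge (N := N) 1
  refine ⟨fun a => h.contDiff_charge _, hi.not_const, hi, fun a b => h.poisson_charge _ _,
    Pi.single ⟨0, hN⟩ (1 / 2), ⟨⟨0, hN⟩, by simp⟩, fun z => ?_⟩
  rw [Hpsi_eq_charge, Finset.sum_eq_single (⟨0, hN⟩ : Fin N)]
  · simp
  · intro b _ hb
    simp [hb]
  · simp

/-! ### Asymptotics of the trajectories -/

theorem omega_fst_eq (h : IsBetheKernel ψ ε) (w : Phase N) (i : Fin N) :
    (omega ψ w).1 i = w.1 i -
      ∑ j, psiTheta ψ ((omega ψ w).1 i - (omega ψ w).1 j) (w.2 i - w.2 j) := by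
  have := congrFun ((h.betheEquations_iff w _).2 rfl).1 i
  rw [h.betheY_eq] at this
  linarith

theorem exists_abs_omega_fst_sub_le (h : IsBetheKernel ψ ε) (w : Phase N) (i : Fin N) :
    ∃ C, ∀ t, |(omega ψ (tau t w)).1 i - w.2 i * t| ≤ C := by
  refine ⟨|w.1 i| + ∑ j, (|psiTheta ψ ε (w.2 i - w.2 j)| + |psiTheta ψ (-ε) (w.2 i - w.2 j)|),
    fun t => ?_⟩
  rw [h.omega_fst_eq]
  calc _ = |w.1 i - ∑ j, psiTheta ψ ((omega ψ (tau t w)).1 i - (omega ψ (tau t w)).1 j)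
        (w.2 i - w.2 j)| := by congr 1; simp only [tau]; ring
    _ ≤ |w.1 i| + |∑ j, psiTheta ψ ((omega ψ (tau t w)).1 i - (omega ψ (tau t w)).1 j)
        (w.2 i - w.2 j)| := abs_sub _ _
    _ ≤ _ := by
      gcongr
      exact (Finset.abs_sum_le_sum_abs _ _).trans
        (Finset.sum_le_sum fun j _ => h.abs_psiTheta_le _ _)

theorem tendsto_omega_fst_div (h : IsBetheKernel ψ ε) (w : Phase N) (i : Fin N) :
    Tendsto (fun t => (omega ψ (tau t w)).1 i / t) atTop (𝓝 (w.2 i)) := by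
  obtain ⟨C, hC⟩ := h.exists_abs_omega_fst_sub_le w i
  have h1 : Tendsto (fun t => ((omega ψ (tau t w)).1 i - w.2 i * t) / t) atTop (𝓝 0) := by
    refine squeeze_zero_norm' ?_ (tendsto_const_nhds.div_atTop (a := C) tendsto_id)
    filter_upwards [eventually_gt_atTop 0] with t ht
    rw [Real.norm_eq_abs, abs_div, abs_of_pos ht]
    exact div_le_div_of_nonneg_right (hC t) ht.le
  have h2 := h1.add_const (w.2 i)
  rw [zero_add] at h2
  refine h2.congr' ?_
  filter_upwards [eventually_ne_atTop 0] with t ht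
  field_simp
  ring

theorem omega_snd_of_separated (h : IsBetheKernel ψ ε) {w : Phase N}
    (hs : ∀ i j, i ≠ j → ε ≤ |(omega ψ w).1 i - (omega ψ w).1 j|) : (omega ψ w).2 = w.2 := by
  funext i
  change w.2 i + _ = _
  rw [Finset.sum_eq_zero, add_zero]
  intro j hj
  exact h.range _ _ (hs i j (Finset.ne_of_mem_erase hj).symm)

/-- With every pair separated in the order of the momenta, each `ψ_θ` has its constant outer value
on the side given by the sign of `θ_i - θ_j`, and each `ψ_x` vanishes. -/
theorem omega_eq_of_sorted (h : IsBetheKernel ψ ε) {w : Phase N} (hw : w ∈ distinctMomenta N)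
    (hs : ∀ i j, w.2 j < w.2 i → ε ≤ (omega ψ w).1 i - (omega ψ w).1 j) :
    omega ψ w = (impact ψ ε w, w.2) := by
  refine Prod.ext (funext fun i => ?_) (h.omega_snd_of_separated fun i j hij => ?_)
  · rw [h.omega_fst_eq]
    refine congrArg (w.1 i - ·) ?_
    refine Finset.sum_congr rfl fun j _ => ?_
    rcases lt_trichotomy (w.2 j) (w.2 i) with hlt | heq | hlt
    · rw [Real.sign_of_pos (sub_pos.2 hlt), mul_one, h.psiTheta_of_le (hs i j hlt)]
    · obtain rfl : j = i := by
        by_contra hne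
        exact hw j i hne heq
      simp
    · rw [Real.sign_of_neg (sub_neg.2 hlt), mul_neg_one,
        h.psiTheta_of_le_neg (by linarith [hs j i hlt])]
  · rcases (hw i j hij).lt_or_gt with hlt | hlt
    · rw [abs_sub_comm]
      exact (hs j i hlt).trans (le_abs_self _)
    · exact (hs i j hlt).trans (le_abs_self _)

theorem omega_eq_of_antisorted (h : IsBetheKernel ψ ε) {w : Phase N}
    (hw : w ∈ distinctMomenta N)
    (hs : ∀ i j, w.2 j < w.2 i → (omega ψ w).1 i - (omega ψ w).1 j ≤ -ε) :
    omega ψ w = (impact ψ (-ε) w, w.2) := by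
  refine Prod.ext (funext fun i => ?_) (h.omega_snd_of_separated fun i j hij => ?_)
  · rw [h.omega_fst_eq]
    refine congrArg (w.1 i - ·) ?_
    refine Finset.sum_congr rfl fun j _ => ?_
    rcases lt_trichotomy (w.2 j) (w.2 i) with hlt | heq | hlt
    · rw [Real.sign_of_pos (sub_pos.2 hlt), mul_one, h.psiTheta_of_le_neg (hs i j hlt)]
    · obtain rfl : j = i := by
        by_contra hne
        exact hw j i hne heq
      simp
    · rw [Real.sign_of_neg (sub_neg.2 hlt), mul_neg_one, neg_neg,
        h.psiTheta_of_le (by linarith [hs j i hlt])]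
  · rcases (hw i j hij).lt_or_gt with hlt | hlt
    · exact (by linarith [hs j i hlt] : ε ≤ _).trans (le_abs_self _)
    · rw [abs_sub_comm]
      exact (by linarith [hs i j hlt] : ε ≤ _).trans (le_abs_self _)

theorem exists_sorted (h : IsBetheKernel ψ ε) (w : Phase N) :
    ∃ T > 0, (∀ t ≥ T, ∀ i j, w.2 j < w.2 i →
        ε ≤ (omega ψ (tau t w)).1 i - (omega ψ (tau t w)).1 j) ∧
      ∀ t ≤ -T, ∀ i j, w.2 j < w.2 i →
        (omega ψ (tau t w)).1 i - (omega ψ (tau t w)).1 j ≤ -ε := by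
  choose C hC using h.exists_abs_omega_fst_sub_le w
  -- The free relative displacement must exceed `ε` plus the two bounded deviations from free
  -- motion.
  have h1 : ∀ᶠ T : ℝ in atTop, ∀ i j, w.2 j < w.2 i →
      ε + C i + C j ≤ (w.2 i - w.2 j) * T := by
    refine eventually_all.2 fun i => eventually_all.2 fun j => ?_
    by_cases hij : w.2 j < w.2 i
    · filter_upwards [(tendsto_id.const_mul_atTop (sub_pos.2 hij)).eventually_ge_atTop
        (ε + C i + C j)] with T hT _ using hT
    · exact Eventually.of_forall fun T hij' => absurd hij' hij
  obtain ⟨T, hT, hpos⟩ := (h1.and (eventually_gt_atTop 0)).exists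
  refine ⟨T, hpos, fun t ht i j hij => ?_, fun t ht i j hij => ?_⟩
  · have hi := abs_le.1 (hC i t)
    have hj := abs_le.1 (hC j t)
    have := mul_le_mul_of_nonneg_left ht (sub_pos.2 hij).le
    linarith [hT i j hij, hi.1, hj.2, sub_mul (w.2 i) (w.2 j) t]
  · have hi := abs_le.1 (hC i t)
    have hj := abs_le.1 (hC j t)
    have := mul_le_mul_of_nonneg_left ht (sub_pos.2 hij).le
    linarith [hT i j hij, hi.2, hj.1, sub_mul (w.2 i) (w.2 j) t]

/-- For large times the trajectories are free. -/
theorem exists_omega_tau_eq (h : IsBetheKernel ψ ε) {w : Phase N} (hw : w ∈ distinctMomenta N) :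
    ∃ T > 0, (∀ t ≥ T, omega ψ (tau t w) = (fun i => w.2 i * t + impact ψ ε w i, w.2)) ∧
      ∀ t ≤ -T, omega ψ (tau t w) = (fun i => w.2 i * t + impact ψ (-ε) w i, w.2) := by
  obtain ⟨T, hpos, h1, h2⟩ := h.exists_sorted w
  refine ⟨T, hpos, fun t ht => ?_, fun t ht => ?_⟩
  · simp only [← impact_tau]
    exact h.omega_eq_of_sorted (w := tau t w) hw (h1 t ht)
  · simp only [← impact_tau]
    exact h.omega_eq_of_antisorted (w := tau t w) hw (h2 t ht)

theorem exists_asymptotically_free (h : IsBetheKernel ψ ε) {w : Phase N}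
    (hw : w ∈ distinctMomenta N) : ∃ T : ℝ, 0 < T ∧
      (∀ t : ℝ, T ≤ |t| → (omega ψ (tau t w)).2 = w.2 ∧
        HasDerivAt (fun s => (omega ψ (tau s w)).1) w.2 t) ∧
      ∃ am ap : Fin N → ℝ,
        (∀ t ≤ -T, ∀ i, (omega ψ (tau t w)).1 i = w.2 i * t + am i) ∧
        (∀ t ≥ T, ∀ i, (omega ψ (tau t w)).1 i = w.2 i * t + ap i) := by
  obtain ⟨T, hpos, h1, h2⟩ := h.exists_omega_tau_eq hw
  have hd : ∀ (a : Fin N → ℝ) (t : ℝ), HasDerivAt (fun s i => w.2 i * s + a i) w.2 t :=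
    fun a t => hasDerivAt_pi.2 fun i => by
      simpa using ((hasDerivAt_id t).const_mul (w.2 i)).add_const (a i)
  -- The extra 1 leaves a neighbourhood of `t` on which the linear formula holds, as differentiation
  -- requires.
  refine ⟨T + 1, by linarith, fun t ht => ?_, impact ψ (-ε) w, impact ψ ε w,
    fun t ht i => by rw [h2 t (by linarith)], fun t ht i => by rw [h1 t (by linarith)]⟩
  rcases le_abs'.1 ht with ht | ht
  · refine ⟨by rw [h2 t (by linarith)], (hd (impact ψ (-ε) w) t).congr_of_eventuallyEq ?_⟩
    filter_upwards [Iio_mem_nhds (by linarith : t < -T)] with s hs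
    rw [h2 s (le_of_lt hs)]
  · refine ⟨by rw [h1 t (by linarith)], (hd (impact ψ ε w) t).congr_of_eventuallyEq ?_⟩
    filter_upwards [Ioi_mem_nhds (by linarith : T < t)] with s hs
    rw [h1 s (le_of_lt hs)]

/-! ### Scattering -/

/-- Each pair moves from one side of the range to the other, so it contributes the jump of `ψ_θ`,
which is `φ`, with the sign of the crossing. -/
theorem impact_sub (h : IsBetheKernel ψ ε) (w : Phase N) (i : Fin N) :
    impact ψ ε w i - impact ψ (-ε) w i =
      ∑ j ∈ Finset.univ.erase i, Real.sign (w.2 j - w.2 i) * phi ψ (w.2 i - w.2 j) := by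
  rw [Finset.sum_erase _ (by simp), impact, impact, sub_sub_sub_cancel_left,
    ← Finset.sum_sub_distrib]
  refine Finset.sum_congr rfl fun j _ => ?_
  rw [h.phi_eq]
  rcases lt_trichotomy (w.2 j) (w.2 i) with hlt | heq | hlt
  · rw [Real.sign_of_pos (sub_pos.2 hlt), Real.sign_of_neg (sub_neg.2 hlt), mul_one, mul_one]
    ring
  · simp [heq]
  · rw [Real.sign_of_neg (sub_neg.2 hlt), Real.sign_of_pos (sub_pos.2 hlt), mul_neg_one,
      mul_neg_one, neg_neg]
    ring

theorem dense_distinctMomenta : Dense (distinctMomenta N) :=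
  (dense_regularMomenta.preimage isOpenMap_snd).mono fun _ hw => hw.2

/-- The phase points whose asymptotic momenta are distinct. -/
def scatteringSet (ψ : ℝ → ℝ → ℝ) (N : ℕ) : Set (Phase N) :=
  {z | omegaInv ψ z ∈ distinctMomenta N}

theorem dense_scatteringSet (h : IsBetheKernel ψ ε) : Dense (scatteringSet ψ N) := by
  refine (h.isC1Diffeo_omega.bijective.surjective.denseRange.dense_image
    h.isC1Diffeo_omega.contDiff.continuous dense_distinctMomenta).mono ?_
  rintro _ ⟨w, hw, rfl⟩
  rwa [scatteringSet, Set.mem_ofPred_eq, h.omegaInv_omega]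

/-- Particle `i` has momentum `θ_i` both before and after all collisions, hence the trivial
permutation. -/
theorem isFactorisedScattering (h : IsBetheKernel ψ ε) :
    IsFactorisedScattering (Hpsi ψ N) (fun θ θ' => phi ψ (θ - θ')) (scatteringSet ψ N) (theta ψ)
      (fun z => impact ψ (-ε) (omegaInv ψ z)) (fun z => impact ψ ε (omegaInv ψ z))
      (fun _ => 1) where
  flow := by
    refine ⟨_, h.isHamiltonianFlow, fun t z hz => ?_⟩
    rw [scatteringSet, Set.mem_ofPred_eq, h.omegaInv_omega]
    exact hz
  dense := h.dense_scatteringSet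
  distinct := fun z hz => hz
  incoming := by
    rintro z hz γ hγ rfl i
    obtain ⟨T, -, -, h2⟩ := h.exists_omega_tau_eq hz
    have he : ∀ᶠ t in atBot, (γ t).2 i = theta ψ (γ 0) i ∧
        (γ t).1 i - theta ψ (γ 0) i * t = impact ψ (-ε) (omegaInv ψ (γ 0)) i := by
      filter_upwards [eventually_le_atBot (-T)] with t ht
      rw [(h.isTrajectory_Hpsi_iff γ).1 hγ t, h2 t ht]
      exact ⟨rfl, add_sub_cancel_left _ _⟩
    exact ⟨tendsto_const_nhds.congr' (he.mono fun t ht => ht.1.symm),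
      tendsto_const_nhds.congr' (he.mono fun t ht => ht.2.symm)⟩
  outgoing := by
    rintro z hz γ hγ rfl i
    obtain ⟨T, -, h1, -⟩ := h.exists_omega_tau_eq hz
    have he : ∀ᶠ t in atTop, (γ t).2 i = theta ψ (γ 0) i ∧
        (γ t).1 i - theta ψ (γ 0) i * t = impact ψ ε (omegaInv ψ (γ 0)) i := by
      filter_upwards [eventually_ge_atTop T] with t ht
      rw [(h.isTrajectory_Hpsi_iff γ).1 hγ t, h1 t ht]
      exact ⟨rfl, add_sub_cancel_left _ _⟩
    exact ⟨tendsto_const_nhds.congr' (he.mono fun t ht => ht.1.symm),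
      tendsto_const_nhds.congr' (he.mono fun t ht => ht.2.symm)⟩
  shift := fun z _ i => h.impact_sub (omegaInv ψ z) i
  bijective := by
    refine ⟨fun z hz => hz, fun z _ z' _ he => ?_, fun v hv => ?_⟩
    · obtain ⟨h1, h2⟩ := Prod.mk.inj he
      have h2 : (omegaInv ψ z).2 = (omegaInv ψ z').2 := h2
      refine h.isC1Diffeo_omegaInv.bijective.injective (Prod.ext (funext fun i => ?_) h2)
      have h3 := congrFun h1 i
      simp only [impact, h2] at h3
      linarith
    -- The incoming impact parameter differs from `y` by a function of `θ` alone, so it is inverted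
    -- by adding that function back.
    · let w : Phase N := (fun i => v.1 i +
        ∑ j, psiTheta ψ (-ε * Real.sign (v.2 i - v.2 j)) (v.2 i - v.2 j), v.2)
      have hw : omegaInv ψ (omega ψ w) = w := h.omegaInv_omega w
      refine ⟨omega ψ w, ?_, ?_⟩
      · rw [scatteringSet, Set.mem_ofPred_eq, hw]
        exact hv
      · simp only [hw, h.theta_omega]
        exact Prod.ext (funext fun i => add_sub_cancel_right _ _) rfl

theorem hasElasticFactorisedScattering (h : IsBetheKernel ψ ε) :
    HasElasticFactorisedScattering (Hpsi ψ) fun θ θ' => phi ψ (θ - θ') :=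
  ⟨h.isManyParticleSystem_Hpsi, h.contDiff_phi, fun _ => ⟨_, _, _, _, _, h.isFactorisedScattering⟩⟩

theorem isFiniteRangeTracerDynamics (h : IsBetheKernel ψ ε) :
    IsFiniteRangeTracerDynamics ε (Hpsi ψ) fun θ θ' => phi ψ (θ - θ') :=
  ⟨h.isManyParticleSystem_Hpsi, h.contDiff_phi, fun _ r z => theta ψ z r,
    fun _ r => contDiff_pi.1 h.contDiff_theta r, fun _ => ⟨_, _, _, _, _, h.isFactorisedScattering,
      fun _ _ => rfl, h.contDiff_theta, fun z _ hI r => h.theta_restrict_cluster z hI r⟩⟩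

end IsBetheKernel

end Bethe

/-! ### The main theorem -/

open Bethe in
theorem theorem2p1 (ψ : ℝ → ℝ → ℝ) (ε : ℝ) (hε : 0 < ε)
    (hψ : ContDiff ℝ 2 (fun q : ℝ × ℝ => ψ q.1 q.2))
    (hpos : ∀ x θ, 0 ≤ psiXTheta ψ x θ)
    (hsymm : ∀ x θ, ψ (-x) (-θ) = ψ x θ)
    (hrange : ∀ x θ, ε ≤ |x| → psiX ψ x θ = 0) :
    -- (a) trajectories
    (∀ N : ℕ,
      -- `ω` and `θ(x, p)` are the unique solutions of the defining equations
      (∀ w z : Phase N, BetheEquations ψ w z ↔ z = omega ψ w) ∧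
      (∀ x p θ : Fin N → ℝ, p = betheP ψ x θ ↔ θ = theta ψ (x, p)) ∧
      -- for fixed `θ`, the maps `y ↦ x` and `x ↦ p`; for fixed `x`, the map `p ↦ θ`
      (∀ θ : Fin N → ℝ, IsC1Diffeo (fun y : Fin N → ℝ => (omega ψ (y, θ)).1)) ∧
      (∀ θ : Fin N → ℝ, ContDiff ℝ 1 (fun x : Fin N → ℝ => betheP ψ x θ)) ∧
      (∀ x : Fin N → ℝ, IsC1Diffeo (fun p : Fin N → ℝ => theta ψ (x, p))) ∧
      -- `ω` is a `C¹` diffeomorphism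
      IsC1Diffeo (omega ψ : Phase N → Phase N) ∧
      -- trajectories exist, are unique and `C¹`
      (∀ w : Phase N, ∃! γ : ℝ → Phase N, ∀ t, BetheEquations ψ (tau t w) (γ t)) ∧
      (∀ w : Phase N, ContDiff ℝ 1 (fun t : ℝ => omega ψ (tau t w))) ∧
      -- and are linear, with `x' = p = θ`, for large `|t|`
      (∀ w ∈ distinctMomenta N, ∃ T : ℝ, 0 < T ∧
        (∀ t : ℝ, T ≤ |t| → (omega ψ (tau t w)).2 = w.2 ∧
          HasDerivAt (fun s => (omega ψ (tau s w)).1) w.2 t) ∧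
        ∃ am ap : Fin N → ℝ,
          (∀ t ≤ -T, ∀ i, (omega ψ (tau t w)).1 i = w.2 i * t + am i) ∧
          (∀ t ≥ T, ∀ i, (omega ψ (tau t w)).1 i = w.2 i * t + ap i))) ∧
    -- (b) Liouville integrability and finite-range interaction
    ((∀ N : ℕ,
      ContDiff ℝ 1 (Hpsi ψ N) ∧
      (∀ z : Phase N, Hpsi ψ N z = ∑ i, z.2 i ^ 2 / 2 + Vpsi ψ N z) ∧
      -- the solutions of Hamilton's equations for `H_ψ` are exactly the trajectories of (a)
      (∀ γ : ℝ → Phase N,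
        IsTrajectory (Hpsi ψ N) γ ↔ ∃ w : Phase N, ∀ t, γ t = omega ψ (tau t w))) ∧
      IsFiniteRangeLiouvilleIntegrable ε (Hpsi ψ) ∧
      HasFiniteRange ε (Vpsi ψ) ∧
      -- explicitly, through the charges `Q_a = ∑ θ_i^a` with dispersion relations `p^a`
      (∀ (N : ℕ) (z : Phase N), Hpsi ψ N z = (1 / 2 : ℝ) * charge ψ 2 N z) ∧
      (∀ a N : ℕ, ContDiff ℝ 1 (charge ψ a N)) ∧
      (∀ (N a b : ℕ) (z : Phase N), poisson (charge ψ a N) (charge ψ b N) z = 0) ∧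
      (∀ N : ℕ, FunctionallyIndependent (fun a : Fin N => charge ψ (a + 1) N)) ∧
      (∀ a : ℕ, HasFiniteRangeInteraction ε (fun p => p ^ a) (charge ψ a)) ∧
      -- asymptotic momenta of a separated cluster `J` depend on that cluster only, and are
      -- obtained by a time-of-flight experiment for the cluster put in the vacuum
      (∀ (N : ℕ) (J : Finset (Fin N)) (z : Phase N),
        (∀ i ∉ J, ∀ j ∈ J, ε < |z.1 i - z.1 j|) →
        ∀ r : Fin J.card,
          theta ψ z (J.orderEmbOfFin rfl r) = theta ψ (restrict J z) r ∧
          ∀ γ : ℝ → Phase J.card, IsTrajectory (Hpsi ψ J.card) γ → γ 0 = restrict J z →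
            Tendsto (fun t => (γ t).1 r / t) atTop
              (𝓝 (theta ψ z (J.orderEmbOfFin rfl r))))) ∧
    -- (c) elastic, factorised scattering; finite-range tracer dynamics
    ((∀ θ, Integrable (fun x => psiXTheta ψ x θ)) ∧
      HasElasticFactorisedScattering (Hpsi ψ) (fun θ θ' => phi ψ (θ - θ')) ∧
      IsFiniteRangeTracerDynamics ε (Hpsi ψ) (fun θ θ' => phi ψ (θ - θ'))) := by
  have h : IsBetheKernel ψ ε := ⟨hε, hψ, hpos, hsymm, hrange⟩
  refine ⟨fun N => ⟨h.betheEquations_iff, h.eq_betheP_iff, h.isC1Diffeo_omega_fst,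
      fun θ => h.contDiff_betheP.comp (contDiff_id.prodMk contDiff_const), h.isC1Diffeo_theta,
      h.isC1Diffeo_omega, fun w => ?_, fun w => h.isC1Diffeo_omega.contDiff.comp (contDiff_tau w),
      fun w hw => h.exists_asymptotically_free hw⟩,
    ⟨fun N => ⟨h.contDiff_Hpsi, IsBetheKernel.Hpsi_eq_add_Vpsi, fun γ => ?_⟩,
      h.isFiniteRangeLiouvilleIntegrable, h.hasFiniteRange_Vpsi, IsBetheKernel.Hpsi_eq_charge,
      fun a N => h.contDiff_charge a, fun N => h.poisson_charge,
      fun N => h.functionallyIndependent_charge 0, h.hasFiniteRangeInteraction_charge,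
      fun N J z hJ r => ⟨h.theta_restrict hJ r, fun γ hγ h0 => ?_⟩⟩,
    h.integrable_psiXTheta, h.hasElasticFactorisedScattering, h.isFiniteRangeTracerDynamics⟩
  · simp only [h.betheEquations_iff]
    exact ⟨_, fun t => rfl, fun γ hγ => funext hγ⟩
  · constructor
    · exact fun hγ => ⟨_, (h.isTrajectory_Hpsi_iff γ).1 hγ⟩
    · rintro ⟨w, hw⟩
      rw [show γ = fun t => omega ψ (tau t w) from funext hw]
      exact h.isTrajectory_omega_tau w
  · rw [h.theta_restrict hJ r, ← h0]
    refine (h.tendsto_omega_fst_div (omegaInv ψ (γ 0)) r).congr fun t => ?_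
    rw [← (h.isTrajectory_Hpsi_iff γ).1 hγ t]
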